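/- Let $\Bbbk$ be a field of characteristic zero and let $\mathcal P$ be a symmetric operad in $\Bbbk$-vector spaces. Let $\Upsilon$ be a finite set of operations of arities at least $2$ which generates $\mathcal P$ as a shuffle operad, i.e. every operation of arity $n\ge 1$ is a linear combination of values of shuffle monomials in $\Upsilon$. Here a shuffle monomial of arity $n$ is a planar rooted tree whose vertices are labelled by elements of $\Upsilon$ (a vertex labelled by an $m$-ary generator has $m$ inputs) and whose leaves are numbered bijectively by $1,\dots,n$ in such a way that at every vertex the inputs are ordered from left to right by the smallest leaf reached through them; its planar skeleton is obtained by erasing the numbers of the leaves. The shuffle monomials form a basis of the free shuffle operad $\mathcal F(\Upsilon)$; let $C\subset\mathcal F(\Upsilon)$ be the ideal of relations of $\mathcal P$, i.e. the kernel of the natural map $\mathcal F(\Upsilon)\to\mathcal P$. Fix an admissible order, i.e. a total order on the shuffle monomials of each arity for which all shuffle compositions are strictly increasing in each argument, and suppose that $C$ has a finite Gröbner basis $G$ (a finite set $G\subset C$ such that the monomial ideal generated by the leading monomials of the elements of $G$ is the ideal of all leading monomials of $C$) which is shuffle regular: if a monomial is the leading monomial of an element of $G$, then so is every shuffle monomial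 with the same planar skeleton. Let $$E_{\mathcal P}(z)=\sum_{n\ge 1}\frac{\dim \mathcal P(n)}{n!}z^n .$$ (a) There are $n\ge N\ge 0$, rational numbers $q^i_{j,l}$ and polynomials $g_i\in\mathbb Q[z]$ ($1\le i,j,l\le n$) such that the system $$y_i'(z)+\sum_{j,l=1}^n q^i_{j,l}\,y_j(z)\,y_l'(z)=g_i(z),\qquad y_i(0)=0,\qquad i=1,\dots,n,$$ has a unique solution $(y_1,\dots,y_n)$ in $\mathbb Q[[z]]^n$, and $E_{\mathcal P}=y_1+\dots+y_N$ for this solution. (b) $E_{\mathcal P}$ is differential algebraic over $\mathbb Q$: there are $n\ge 0$ and a non-constant polynomial $\theta$ in $n+2$ variables over $\mathbb Q$ with $\theta\bigl(z,E_{\mathcal P}(z),E_{\mathcal P}'(z),\dots,E_{\mathcal P}^{(n)}(z)\bigr)=0$. (c) Suppose that integer degrees of the generators are given for which the ideal $C$ is homogeneous (the degree of a monomial being the sum of the degrees of the labels of its vertices), let $\mathcal P(n)=\bigoplus_{d\in\mathbb Z}\mathcal P(n)_d$ be the induced grading, and put $$E_{\mathcal P}(z,t)=\sum_{n\ge 1}\frac{z^n}{n!}\sum_{d\in\mathbb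 Z}\dim \mathcal P(n)_d\; t^d\in\mathbb Q[t,t^{-1}][[z]].$$ Then $E_{\mathcal P}(z,t)$ is differential algebraic over $\mathbb Q[t]$ with respect to $d/dz$ (with $dt/dz=0$): there are $n\ge0$ and a non-constant polynomial $\theta$ in $n+2$ variables over $\mathbb Q[t]$ with $\theta\bigl(z,E_{\mathcal P},\partial_zE_{\mathcal P},\dots,\partial_z^nE_{\mathcal P}\bigr)=0$. -/

import Mathlib

open scoped LaurentPolynomial

noncomputable section

/-! ### Symmetric operads -/

/-- The standard identification of the disjoint union of `Fin (κ 0), Fin (κ 1), …` with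
`Fin (κ 0 + κ 1 + ⋯)`, block after block. -/
abbrev blockEquiv {n : ℕ} (κ : Fin n → ℕ) : (Σ i : Fin n, Fin (κ i)) ≃ Fin (∑ i, κ i) :=
  finSigmaFinEquiv

/-- A symmetric operad in vector spaces over `k` (classical definition by the compositions
`γ(p; q₁, …, qₙ)`).  A bijection `Fin n ≃ Fin m` exists only for `n = m`, so `map` is exactly an
action of the symmetric group `S_n` on `P(n)` for every `n`: `map σ p` is the operation `p` with its
input `i` renamed `σ i`. Allowing `m` to be a different expression for the same number
lets `map` also absorb the identifications `P(n) = P(m)` in the axioms. -/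
structure SymmetricOperad (k : Type*) [Field k] where
  obj : ℕ → Type*
  [addCommGroup : ∀ n, AddCommGroup (obj n)]
  [module : ∀ n, Module k (obj n)]
  map : ∀ {n m : ℕ}, (Fin n ≃ Fin m) → obj n →ₗ[k] obj m
  map_refl : ∀ {n : ℕ} (p : obj n), map (Equiv.refl (Fin n)) p = p
  map_trans : ∀ {n m l : ℕ} (σ : Fin n ≃ Fin m) (τ : Fin m ≃ Fin l) (p : obj n),
    map (σ.trans τ) p = map τ (map σ p)
  /-- the identity operation -/
  one : obj 1
  /-- the composition `γ(p; q₁, …, qₙ)`, whose inputs are those of `q₁`, then those of `q₂`, … -/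
  comp : ∀ {n : ℕ} (κ : Fin n → ℕ),
    obj n →ₗ[k] MultilinearMap k (fun i : Fin n => obj (κ i)) (obj (∑ i, κ i))
  one_comp : ∀ {n : ℕ} (p : obj n),
    comp (fun _ : Fin 1 => n) one (fun _ => p) = map (finCongr (by simp)) p
  comp_one : ∀ {n : ℕ} (p : obj n),
    comp (fun _ : Fin n => 1) p (fun _ => one) = map (finCongr (by simp)) p
  comp_assoc : ∀ {n : ℕ} (κ : Fin n → ℕ) (l : Fin (∑ i, κ i) → ℕ)
    (p : obj n) (q : ∀ i, obj (κ i)) (r : ∀ x, obj (l x)),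
    comp l (comp κ p q) r =
      map ((blockEquiv fun i => ∑ j, l (blockEquiv κ ⟨i, j⟩)).symm.trans
          ((Equiv.sigmaCongrRight fun i => (blockEquiv fun j => l (blockEquiv κ ⟨i, j⟩)).symm).trans
          ((Equiv.sigmaAssoc fun i j => Fin (l (blockEquiv κ ⟨i, j⟩))).symm.trans
          ((Equiv.sigmaCongrLeft (β := fun x => Fin (l x)) (blockEquiv κ)).trans (blockEquiv l)))))
        (comp (fun i => ∑ j, l (blockEquiv κ ⟨i, j⟩)) p
          fun i => comp (fun j => l (blockEquiv κ ⟨i, j⟩)) (q i) fun j => r (blockEquiv κ ⟨i, j⟩))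
  /-- equivariance in the outer operation -/
  comp_map_left : ∀ {n m : ℕ} (σ : Fin n ≃ Fin m) (κ : Fin m → ℕ)
    (p : obj n) (q : ∀ j, obj (κ j)),
    comp κ (map σ p) q =
      map ((blockEquiv fun i => κ (σ i)).symm.trans
          ((Equiv.sigmaCongrLeft (β := fun j => Fin (κ j)) σ).trans (blockEquiv κ)))
        (comp (fun i => κ (σ i)) p fun i => q (σ i))
  /-- equivariance in the inner operations -/
  comp_map_right : ∀ {n : ℕ} (κ l : Fin n → ℕ) (τ : ∀ i, Fin (κ i) ≃ Fin (l i))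
    (p : obj n) (q : ∀ i, obj (κ i)),
    comp l p (fun i => map (τ i) (q i)) =
      map ((blockEquiv κ).symm.trans ((Equiv.sigmaCongrRight τ).trans (blockEquiv l)))
        (comp κ p q)

attribute [instance] SymmetricOperad.addCommGroup SymmetricOperad.module

/-! ### Planar trees with labelled leaves, shuffle monomials -/

/-- Planar rooted trees whose vertices are labelled by elements `v` of `Υ`, where a vertex labelled
`v` has `ar v` ordered inputs, and whose leaves are labelled by elements of `L`. -/
inductive OpTree {Υ : Type*} (ar : Υ → ℕ) (L : Type*) : Type _
  | leaf (x : L) : OpTree ar L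
  | node (v : Υ) (c : Fin (ar v) → OpTree ar L) : OpTree ar L

namespace OpTree

variable {Υ : Type*} {ar : Υ → ℕ} {L M : Type*}

/-- The number of leaves. -/
def arity : OpTree ar L → ℕ
  | leaf _ => 1
  | node _ c => ∑ i, (c i).arity

/-- The label of the `p`-th leaf, the leaves being counted from left to right. -/
def label : (t : OpTree ar L) → Fin t.arity → L
  | leaf x => fun _ => x
  | node _ c => fun p =>
      let q := (blockEquiv fun i => (c i).arity).symm p
      (c q.1).label q.2

/-- The set of all labels of leaves. -/
def leaves : OpTree ar L → Set L
  | leaf x => {x}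
  | node _ c => ⋃ i, (c i).leaves

/-- Replace every leaf labelled `x` by the tree `f x`. -/
def bind : OpTree ar L → (L → OpTree ar M) → OpTree ar M
  | leaf x, f => f x
  | node v c, f => node v fun i => (c i).bind f

/-- Replace every label `x` of a leaf by `f x`. -/
def relabel (f : L → M) (t : OpTree ar L) : OpTree ar M :=
  t.bind fun x => leaf (f x)

/-- The planar skeleton: the labels of the leaves are erased. -/
def skeleton (t : OpTree ar L) : OpTree ar Unit :=
  t.relabel fun _ => ()

/-- `u` is the full subtree of `t` above some edge of `t` (`t` itself and leaves included). -/
def IsAbove (u : OpTree ar L) : OpTree ar L → Prop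
  | leaf x => u = leaf x
  | node v c => u = node v c ∨ ∃ i, IsAbove u (c i)

/-- The smallest label of a leaf of `s` is smaller than the smallest label of a leaf of `t`. -/
def MinLT [LT L] (s t : OpTree ar L) : Prop :=
  ∃ x ∈ s.leaves, ∀ y ∈ t.leaves, x < y

/-- At every vertex the inputs are ordered by the minima of the leaves reached through them. -/
def IsShuffle [LT L] : OpTree ar L → Prop
  | leaf _ => True
  | node _ c => (∀ i j, i < j → MinLT (c i) (c j)) ∧ ∀ i, (c i).IsShuffle

/-- Additive degree of a tree for given degrees of the vertex labels. -/
def degree (deg : Υ → ℤ) : OpTree ar L → ℤ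
  | leaf _ => 0
  | node v c => deg v + ∑ i, (c i).degree deg

end OpTree

/-- Shuffle monomials of arity `n` in the generators `Υ`, through their canonical planar
realizations: the leaves are numbered bijectively by `0, …, n - 1` and at every vertex the inputs
are ordered by minimal leaves.  The monomials of arity `n` form a basis of the `n`-th component of
the free shuffle operad generated by `Υ`. -/
def ShuffleMonomial {Υ : Type*} (ar : Υ → ℕ) (n : ℕ) : Type _ :=
  {t : OpTree ar (Fin n) // t.IsShuffle ∧ Function.Bijective t.label}

/-- `w` divides `v`: some subtree of `v` is isomorphic to `w` (it is `w` with trees `f i` of `v`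
attached to its inputs `i`), and the order of the inputs of `w` is the order of the minima of
the leaves of `v` that are reached through these inputs. -/
def ShuffleMonomial.Divides {Υ : Type*} {ar : Υ → ℕ} {m n : ℕ}
    (w : ShuffleMonomial ar m) (v : ShuffleMonomial ar n) : Prop :=
  ∃ f : Fin m → OpTree ar (Fin n),
    (w.1.bind f).IsAbove v.1 ∧ ∀ i j, i < j → OpTree.MinLT (f i) (f j)

/-- A set of shuffle monomials is shuffle regular if with each monomial it contains all
monomials with the same planar skeleton. -/
def ShuffleRegular {Υ : Type*} {ar : Υ → ℕ} (S : Set (Σ n, ShuffleMonomial ar n)) : Prop :=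
  ∀ (n : ℕ) (m m' : ShuffleMonomial ar n),
    (⟨n, m⟩ : Σ n, ShuffleMonomial ar n) ∈ S → m'.1.skeleton = m.1.skeleton →
      (⟨n, m'⟩ : Σ n, ShuffleMonomial ar n) ∈ S

/-! ### Admissible orders and Gröbner bases -/

/-- The data of a shuffle composition `α ∘ᵢ β` of an operation `α` of arity `n` with an operation
`β` of arity `m`: the input `i` of `α`, and the increasing renumberings `a` and `b` of the inputs of
`α` and of `β` by the numbers of the `N = n + m - 1` inputs of the composition, such that
the minimal input of `β` takes the place of `i` in the numbering of `α`. -/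
structure ShuffleInsertion (n m N : ℕ) where
  i : Fin n
  a : Fin n ↪o Fin N
  b : Fin m ↪o Fin N
  cover : ∀ x, x ∈ Set.range a ∨ x ∈ Set.range b
  meet : ∀ j l, a j = b l → j = i
  isLeast : IsLeast (Set.range b) (a i)

/-- The tree of the shuffle composition: `β`, renumbered by `b`, is attached to the input `i` of
`α`, the other inputs of `α` being renumbered by `a`. -/
def ShuffleInsertion.glue {Υ : Type*} {ar : Υ → ℕ} {n m N : ℕ} (s : ShuffleInsertion n m N)
    (α : OpTree ar (Fin n)) (β : OpTree ar (Fin m)) : OpTree ar (Fin N) :=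
  α.bind fun x => if x = s.i then β.relabel s.b else OpTree.leaf (s.a x)

/-- An admissible order: a total order on the monomials of each arity such that all shuffle
compositions are strictly increasing in both arguments. -/
structure AdmissibleOrder {Υ : Type*} (ar : Υ → ℕ) where
  lt : ∀ {n : ℕ}, ShuffleMonomial ar n → ShuffleMonomial ar n → Prop
  total : ∀ n : ℕ, IsStrictTotalOrder (ShuffleMonomial ar n) lt
  glue_left : ∀ {n m N : ℕ} (s : ShuffleInsertion n m N) (α α' : ShuffleMonomial ar n)
    (β : ShuffleMonomial ar m) (w w' : ShuffleMonomial ar N),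
    w.1 = s.glue α.1 β.1 → w'.1 = s.glue α'.1 β.1 → lt α α' → lt w w'
  glue_right : ∀ {n m N : ℕ} (s : ShuffleInsertion n m N) (α : ShuffleMonomial ar n)
    (β β' : ShuffleMonomial ar m) (w w' : ShuffleMonomial ar N),
    w.1 = s.glue α.1 β.1 → w'.1 = s.glue α.1 β'.1 → lt β β' → lt w w'

/-- The `n`-th component of the free shuffle operad generated by `Υ`. -/
abbrev FreeShuffle (k : Type*) [Field k] {Υ : Type*} (ar : Υ → ℕ) (n : ℕ) : Type _ :=
  ShuffleMonomial ar n →₀ k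

/-- `m` is the leading monomial of `f` (the element `0` has none). -/
def AdmissibleOrder.IsLeading {k : Type*} [Field k] {Υ : Type*} {ar : Υ → ℕ}
    (ord : AdmissibleOrder ar) {n : ℕ} (f : FreeShuffle k ar n) (m : ShuffleMonomial ar n) : Prop :=
  m ∈ f.support ∧ ∀ m' ∈ f.support, m' ≠ m → ord.lt m' m

/-- The leading monomials of the elements of a set `S`. -/
def AdmissibleOrder.leadingMonomials {k : Type*} [Field k] {Υ : Type*} {ar : Υ → ℕ}
    (ord : AdmissibleOrder ar) (S : Set (Σ n, FreeShuffle k ar n)) :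
    Set (Σ n, ShuffleMonomial ar n) :=
  {m | ∃ f : FreeShuffle k ar m.1,
    (⟨m.1, f⟩ : Σ n, FreeShuffle k ar n) ∈ S ∧ ord.IsLeading f m.2}

/-- The monomials of the monomial ideal generated by a set of monomials. -/
def monomialMultiples {Υ : Type*} {ar : Υ → ℕ} (S : Set (Σ n, ShuffleMonomial ar n)) :
    Set (Σ n, ShuffleMonomial ar n) :=
  {v | ∃ w ∈ S, w.2.Divides v.2}

namespace SymmetricOperad

variable {k : Type*} [Field k] (P : SymmetricOperad k) {Υ : Type*} {ar : Υ → ℕ}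
  (x : ∀ v, P.obj (ar v))

/-- The operation given by a planar tree whose vertices stand for the operations `x v`, the inputs
being numbered from left to right. -/
def planarEval {L : Type*} : (t : OpTree ar L) → P.obj t.arity
  | .leaf _ => P.one
  | .node v c => P.comp (fun i => (c i).arity) (x v) fun i => planarEval (c i)

/-- The value of a shuffle monomial in `P`: its inputs are numbered by the labels of the leaves. -/
def eval {n : ℕ} (m : ShuffleMonomial ar n) : P.obj n :=
  P.map (Equiv.ofBijective m.1.label m.2.2) (P.planarEval x m.1)

/-- The component of arity `n` of the ideal of relations: the kernel of the map
from the free shuffle operad generated by `Υ` to `P`, considered as a shuffle operad. -/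
def relations (n : ℕ) : Submodule k (FreeShuffle k ar n) :=
  LinearMap.ker (Finsupp.linearCombination k (P.eval (n := n) x))

/-- The ideal of relations, as a set of elements of the free shuffle operad. -/
def relationSet : Set (Σ n, FreeShuffle k ar n) :=
  {f | f.2 ∈ P.relations x f.1}

/-- The operations `x v` generate `P` as a shuffle operad (components of arity at least one). -/
def IsGeneratedBy : Prop :=
  ∀ n : ℕ, 1 ≤ n → Submodule.span k (Set.range (P.eval (n := n) x)) = ⊤

/-- `G` is a Gröbner basis of the ideal of relations: it is contained in this ideal, and its
leading monomials generate the monomial ideal of all leading monomials of the ideal. -/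
def IsGroebnerBasis (ord : AdmissibleOrder ar) (G : Set (Σ n, FreeShuffle k ar n)) : Prop :=
  G ⊆ P.relationSet x ∧
    monomialMultiples (ord.leadingMonomials G) = ord.leadingMonomials (P.relationSet x)

/-- The exponential generating series `∑_{n ≥ 1} dim P(n) zⁿ / n!`. -/
def expSeries : PowerSeries ℚ :=
  PowerSeries.mk fun n => if n = 0 then 0 else (Module.finrank k (P.obj n) : ℚ) / n.factorial

/-- The ideal of relations is homogeneous for the degrees `deg` of the generators: it contains
the homogeneous components of its elements. -/
def HomogeneousRelations (deg : Υ → ℤ) : Prop :=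
  ∀ (n : ℕ), ∀ f ∈ P.relations x n, ∀ d : ℤ,
    f.filter (fun m => m.1.degree deg = d) ∈ P.relations x n

/-- The component of degree `d` of `P(n)`. -/
def gradedPart (deg : Υ → ℤ) (n : ℕ) (d : ℤ) : Submodule k (P.obj n) :=
  Submodule.span k (P.eval x '' {m : ShuffleMonomial ar n | m.1.degree deg = d})

/-- The Hilbert series `∑_d dim P(n)_d t^d` of `P(n)` (a finite sum, for finitely many generators of
arity at least two). -/
def hilbert (deg : Υ → ℤ) (n : ℕ) : ℚ[T;T⁻¹] :=
  ∑ᶠ d : ℤ, (Module.finrank k (P.gradedPart x deg n d) : ℚ) • LaurentPolynomial.T d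

/-- The two-variable series `∑_{n ≥ 1} H_{P(n)}(t) zⁿ / n!`. -/
def gradedExpSeries (deg : Υ → ℤ) : PowerSeries ℚ[T;T⁻¹] :=
  PowerSeries.mk fun n => if n = 0 then 0 else ((n.factorial : ℚ)⁻¹) • P.hilbert x deg n

end SymmetricOperad

/-! ### Differential equations for formal power series -/

/-- The power series `f` in `z` over `S` satisfies `θ(z, f, f', …, f⁽ⁿ⁾) = 0` for some `n` and some
non-constant polynomial `θ` in `n + 2` variables with coefficients in `R`. -/
def DifferentialAlgebraic (R : Type*) [CommRing R] {S : Type*} [CommRing S] [Algebra R S]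
    (f : PowerSeries S) : Prop :=
  ∃ (n : ℕ) (θ : MvPolynomial (Fin (n + 2)) R),
    (∀ c : R, θ ≠ MvPolynomial.C c) ∧
      MvPolynomial.aeval
        (Fin.cons PowerSeries.X fun i : Fin (n + 1) => (PowerSeries.derivative S)^[(i : ℕ)] f :
          Fin (n + 2) → PowerSeries S) θ = 0

/-- `y` solves `yᵢ' + ∑_{j,l} q i j l yⱼ yₗ' = gᵢ(z)`, `yᵢ(0) = 0`. -/
def SolvesQuadraticSystem {n : ℕ} (q : Fin n → Fin n → Fin n → ℚ) (g : Fin n → Polynomial ℚ)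
    (y : Fin n → PowerSeries ℚ) : Prop :=
  ∀ i, PowerSeries.constantCoeff (y i) = 0 ∧
    PowerSeries.derivative ℚ (y i) +
      ∑ j, ∑ l, q i j l • (y j * PowerSeries.derivative ℚ (y l)) = (g i : PowerSeries ℚ)

end

/-!
# Differential equations for operads with a finite shuffle regular Gröbner basis

Linear algebra identifies `dim P(n)` with the number of normal shuffle monomials of arity `n`, those
which are not leading monomials of relations; in the graded case this holds degree by degree
(`SymmetricOperad.finrank_gradedPart`). By the Gröbner basis hypothesis, the normal monomials are
the monomials not divisible by a leading monomial of the basis. As these leading monomials form a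
shuffle regular set, divisibility can be read off from the planar skeleton: an occurrence of a
planar pattern becomes a division once the leaves of the pattern are numbered by the minima above
them (`notMem_monomialMultiples_iff`). So the dimensions count all the shuffle labellings of the
planar trees which avoid a finite set of patterns.

A planar tree with `n` leaves has `n! * λ` shuffle labellings, where `λ` is the product over the
vertices of the fractions `n₁ / (n₁ + ⋯ + nₘ) * n₂ / (n₂ + ⋯ + nₘ) * ⋯`, with `nᵢ` the number of
leaves above the `i`-th input (`ncard_shuffleMonomial_skeleton`). Exponential generating series thus
become sums of `λ * z ^ n` over planar trees, and the series `Z` of tuples of trees from classes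
with series `Y₁, …, Yₘ` satisfies `Z' = Y₁' * Z₁`, where `Z₁` is the series of the tuples of the
remaining `m - 1` classes (`derivative_forestSeries_succ`).

Avoidance of a finite set of patterns is recognised by a finite bottom-up automaton on planar trees
(`OpTree.exists_automaton_avoids`). A tree is a leaf or a vertex with a tuple of trees, so the
derivatives of the series of the states and of tuples of states are linear combinations of `1` and
of products `Y * Y'` (`exists_quadraticallyClosed`), because every vertex has at least two inputs.
This is the quadratic system; its solution is unique since each coefficient is determined by the
lower ones. Degrees of the generators enter as weights `T ^ deg v` of the vertices.

The quadratic system is linear in the derivatives, and its matrix is the identity at `z = 0`, hence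
invertible. Therefore `z`, the solutions and the inverse of one determinant generate an algebra
closed under the derivation, of finite transcendence degree, in which the successive derivatives of
a solution cannot be algebraically independent (`IsQuadraticallyClosed.differentialAlgebraic`).
-/

noncomputable section

/-! ### Quadratic differential systems of power series -/

section QuadraticSystems

open PowerSeries

/-- A set of power series without constant terms whose derivatives are linear combinations of `1`
and of products `a * b'` with `a`, `b` in the set: its elements solve a quadratic system. -/
def IsQuadraticallyClosed {R : Type*} [CommRing R] (𝒴 : Set R⟦X⟧) : Prop :=
  ∀ f ∈ 𝒴, constantCoeff f = 0 ∧
    derivative R f ∈ Submodule.span R (insert 1 {h | ∃ a ∈ 𝒴, ∃ b ∈ 𝒴, h = a * derivative R b})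

lemma IsQuadraticallyClosed.exists_system {R : Type*} [CommRing R] {𝒴 : Set R⟦X⟧}
    (h𝒴 : IsQuadraticallyClosed 𝒴) {n : ℕ} (Y : Fin n → R⟦X⟧) (hY : Set.range Y = 𝒴) :
    ∃ (q : Fin n → Fin n → Fin n → R) (g : Fin n → R), ∀ i,
      derivative R (Y i) + ∑ j, ∑ l, q i j l • (Y j * derivative R (Y l)) = C (g i) := by
  have key : ∀ i, ∃ (q : Fin n → Fin n → R) (g : R),
      derivative R (Y i) + ∑ j, ∑ l, q j l • (Y j * derivative R (Y l)) = C g := by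
    intro i
    have h := (h𝒴 (Y i) (hY ▸ Set.mem_range_self i)).2
    have hset : {h | ∃ a ∈ 𝒴, ∃ b ∈ 𝒴, h = a * derivative R b} =
        Set.range fun p : Fin n × Fin n => Y p.1 * derivative R (Y p.2) := by
      ext h
      subst hY
      simp [eq_comm]
    rw [hset, Submodule.mem_span_insert] at h
    obtain ⟨g, z, hz, hd⟩ := h
    obtain ⟨c, hc⟩ := (Submodule.mem_span_range_iff_exists_fun R).1 hz
    refine ⟨fun j l => -c (j, l), g, ?_⟩
    rw [hd, ← hc, Fintype.sum_prod_type]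
    simp [← Algebra.algebraMap_eq_smul_one]
  choose q g h using key
  exact ⟨q, g, h⟩

/-- The coefficient of `z ^ (n + 1)` of a solution is determined by the lower ones. -/
lemma SolvesQuadraticSystem.unique {n : ℕ} {q : Fin n → Fin n → Fin n → ℚ}
    {g : Fin n → Polynomial ℚ} {y y' : Fin n → PowerSeries ℚ}
    (h : SolvesQuadraticSystem q g y) (h' : SolvesQuadraticSystem q g y') : y' = y := by
  have key : ∀ m : ℕ, ∀ i, coeff m (y' i) = coeff m (y i) := by
    intro m
    induction m using Nat.strong_induction_on with
    | _ m ih =>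
      intro i
      rcases m with _ | m
      · simpa using (h' i).1.trans (h i).1.symm
      · have e := congrArg (coeff m) ((h' i).2.trans (h i).2.symm)
        have hs : coeff m (∑ j, ∑ l, q i j l • (y' j * derivative ℚ (y' l))) =
            coeff m (∑ j, ∑ l, q i j l • (y j * derivative ℚ (y l))) := by
          simp only [map_sum, map_smul, coeff_mul]
          refine Finset.sum_congr rfl fun j _ => Finset.sum_congr rfl fun l _ => ?_
          congr 1
          refine Finset.sum_congr rfl fun p hp => ?_
          have hp' := Finset.HasAntidiagonal.mem_antidiagonal.1 hp
          rcases Nat.eq_zero_or_pos p.1 with h0 | h0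
          · have e1 : coeff 0 (y' j) = 0 := by simpa using (h' j).1
            have e2 : coeff 0 (y j) = 0 := by simpa using (h j).1
            rw [h0, e1, e2, zero_mul, zero_mul]
          · rw [coeff_derivative, coeff_derivative, ih p.1 (by omega) j, ih (p.2 + 1) (by omega) l]
        rw [map_add, map_add, hs, add_left_inj, coeff_derivative, coeff_derivative] at e
        exact mul_right_cancel₀ (by positivity) e
  funext i
  ext m
  exact key m i

/-- Every element of a finite quadratically closed set over `ℚ` is a partial sum of the solution of
a system with unique solution: the element itself is put in front. -/
lemma IsQuadraticallyClosed.exists_solvesQuadraticSystem {𝒴 : Set ℚ⟦X⟧}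
    (h𝒴 : IsQuadraticallyClosed 𝒴) (hfin : 𝒴.Finite) {f : ℚ⟦X⟧} (hf : f ∈ 𝒴) :
    ∃ (n N : ℕ) (_ : N ≤ n) (q : Fin n → Fin n → Fin n → ℚ) (g : Fin n → Polynomial ℚ)
      (y : Fin n → PowerSeries ℚ),
        SolvesQuadraticSystem q g y ∧ (∀ y', SolvesQuadraticSystem q g y' → y' = y) ∧
        f = ∑ i ∈ Finset.univ.filter (fun i : Fin n => (i : ℕ) < N), y i := by
  obtain ⟨m, Z, hZ⟩ := hfin.fin_embedding
  have hr : Set.range (Fin.cons f Z : Fin (m + 1) → ℚ⟦X⟧) = 𝒴 := by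
    rw [Fin.range_cons, hZ, Set.insert_eq_of_mem hf]
  obtain ⟨q, g, hs⟩ := h𝒴.exists_system (Fin.cons f Z) hr
  have hsol : SolvesQuadraticSystem q (fun i => Polynomial.C (g i)) (Fin.cons f Z) := fun i =>
    ⟨(h𝒴 _ (hr ▸ Set.mem_range_self i)).1, by rw [hs i, Polynomial.coe_C]⟩
  refine ⟨m + 1, 1, by omega, q, _, _, hsol, fun y' hy' => hsol.unique hy', ?_⟩
  have : Finset.univ.filter (fun i : Fin (m + 1) => (i : ℕ) < 1) = {0} := by
    ext i
    simp only [Finset.mem_filter, Finset.mem_univ, true_and, Finset.mem_singleton, Fin.ext_iff,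
      Nat.lt_one_iff, Fin.val_zero]
  rw [this, Finset.sum_singleton, Fin.cons_zero]

lemma Matrix.det_mem_subalgebra {R S : Type*} [CommRing R] [CommRing S] [Algebra R S] {n : ℕ}
    (A : Subalgebra R S) {M : Matrix (Fin n) (Fin n) S} (h : ∀ i j, M i j ∈ A) : M.det ∈ A := by
  rw [Matrix.det_apply]
  exact sum_mem fun σ _ => Subalgebra.zsmul_mem _ (prod_mem fun i _ => h _ _) _

lemma Matrix.adjugate_mem_subalgebra {R S : Type*} [CommRing R] [CommRing S] [Algebra R S] {n : ℕ}
    (A : Subalgebra R S) {M : Matrix (Fin n) (Fin n) S} (h : ∀ i j, M i j ∈ A) (i j : Fin n) :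
    M.adjugate i j ∈ A := by
  rw [Matrix.adjugate_apply]
  refine Matrix.det_mem_subalgebra A fun a b => ?_
  rw [Matrix.updateRow_apply]
  split_ifs
  · rw [Pi.single_apply]
    split_ifs
    exacts [one_mem _, zero_mem _]
  · exact h a b

/-- A solution of a quadratic system generates, together with `z` and the inverse of one
determinant, an algebra which is closed under the derivation: the system is linear in the
derivatives, with a matrix which is the identity at `z = 0`. -/
lemma exists_det_inverse_closed {R : Type*} [CommRing R] {n : ℕ} (Y : Fin n → R⟦X⟧)
    (q : Fin n → Fin n → Fin n → R) (g : Fin n → R) (h0 : ∀ i, constantCoeff (Y i) = 0)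
    (hs : ∀ i, derivative R (Y i) + ∑ j, ∑ l, q i j l • (Y j * derivative R (Y l)) = C (g i)) :
    ∃ d e : R⟦X⟧, d ∈ Algebra.adjoin R (insert X (Set.range Y)) ∧ d * e = 1 ∧
      ∀ f ∈ Algebra.adjoin R (insert e (insert X (Set.range Y))),
        derivative R f ∈ Algebra.adjoin R (insert e (insert X (Set.range Y))) := by
  classical
  set B := Algebra.adjoin R (insert X (Set.range Y)) with hB
  let M : Matrix (Fin n) (Fin n) R⟦X⟧ := 1 + Matrix.of fun i l => ∑ j, q i j l • Y j
  have hYB : ∀ i, Y i ∈ B := fun i => Algebra.subset_adjoin (Or.inr ⟨i, rfl⟩)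
  have hMB : ∀ i l, M i l ∈ B := fun i l => by
    simp only [M, Matrix.add_apply, Matrix.of_apply, Matrix.one_apply]
    refine add_mem ?_ (sum_mem fun j _ => Subalgebra.smul_mem _ (hYB j) _)
    split_ifs
    exacts [one_mem _, zero_mem _]
  -- the system reads `M * Y' = g`, so that `det M * Y' = adj M * g`
  have hMd : M.mulVec (fun l => derivative R (Y l)) = fun i => C (g i) := by
    funext i
    rw [← hs i, Matrix.add_mulVec, Matrix.one_mulVec, Pi.add_apply, Finset.sum_comm]
    simp only [Matrix.mulVec, dotProduct, Matrix.of_apply, Finset.sum_mul, smul_mul_assoc]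
  have hdet : IsUnit M.det := by
    rw [PowerSeries.isUnit_iff_constantCoeff, RingHom.map_det]
    have : (constantCoeff (R := R)).mapMatrix M = 1 := by
      ext i l
      simp only [M, RingHom.mapMatrix_apply, Matrix.map_apply, Matrix.add_apply, Matrix.of_apply,
        map_add, map_sum, Matrix.one_apply]
      rw [Finset.sum_eq_zero, add_zero]
      · split_ifs <;> simp
      · intro j _
        rw [PowerSeries.smul_eq_C_mul, map_mul, h0, mul_zero]
    rw [this, Matrix.det_one]
    exact isUnit_one
  obtain ⟨e, he⟩ := hdet.exists_right_inv
  refine ⟨M.det, e, Matrix.det_mem_subalgebra B hMB, he, ?_⟩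
  set A := Algebra.adjoin R (insert e (insert X (Set.range Y))) with hA
  have hBA : B ≤ A := Algebra.adjoin_mono (Set.subset_insert _ _)
  have heA : e ∈ A := Algebra.subset_adjoin (Or.inl rfl)
  have hdY : ∀ i, derivative R (Y i) ∈ A := by
    intro i
    have h1 : M.det • (fun l => derivative R (Y l)) = M.adjugate.mulVec fun i => C (g i) := by
      rw [← hMd, Matrix.mulVec_mulVec, Matrix.adjugate_mul, Matrix.smul_mulVec, Matrix.one_mulVec]
    have h2 : derivative R (Y i) = e * (M.adjugate.mulVec fun i => C (g i)) i := by
      rw [← h1, Pi.smul_apply, smul_eq_mul, ← mul_assoc, mul_comm e, he, one_mul]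
    rw [h2, Matrix.mulVec, dotProduct]
    refine mul_mem heA (sum_mem fun j _ => mul_mem ?_ ?_)
    · exact hBA (Matrix.adjugate_mem_subalgebra B hMB i j)
    · exact algebraMap_mem A (g j)
  have closed : ∀ s : Set R⟦X⟧, Algebra.adjoin R s ≤ A → (∀ f ∈ s, derivative R f ∈ A) →
      ∀ f ∈ Algebra.adjoin R s, derivative R f ∈ A := by
    intro s hsA hsd f hf
    induction hf using Algebra.adjoin_induction with
    | mem f hf => exact hsd f hf
    | algebraMap r =>
      rw [Derivation.map_algebraMap]
      exact zero_mem _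
    | add f g _ _ h1 h2 =>
      rw [map_add]
      exact add_mem h1 h2
    | mul f g hf hg h1 h2 =>
      rw [Derivation.leibniz]
      exact add_mem (mul_mem (hsA hf) h2) (mul_mem (hsA hg) h1)
  have hdB : ∀ f ∈ B, derivative R f ∈ A := by
    refine closed _ hBA ?_
    rintro f (rfl | ⟨i, rfl⟩)
    · rw [derivative_X]
      exact one_mem _
    · exact hdY i
  refine closed _ le_rfl ?_
  rintro f (rfl | hf)
  · -- differentiate `det M * e = 1`
    have h1 := congrArg (derivative R) he
    rw [Derivation.leibniz, derivative_one, smul_eq_mul, smul_eq_mul] at h1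
    have h2 : derivative R f = -(f * f * derivative R M.det) := by
      linear_combination f * h1 - derivative R f * he
    rw [h2]
    exact neg_mem (mul_mem (mul_mem heA heA) (hdB _ (Matrix.det_mem_subalgebra B hMB)))
  · exact hdB f (Algebra.subset_adjoin hf)

/-- More elements than the number of generators, all algebraic over the algebra they generate,
are algebraically dependent. -/
lemma not_algebraicIndependent_of_algebraic_adjoin {R A : Type*} [CommRing R] [CommRing A]
    [Algebra R A] [FaithfulSMul R A] [IsDomain A] (s : Set A) {m : ℕ}
    (hs : s.encard ≤ m) (F : Fin (m + 1) → A)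
    (hF : ∀ i, IsAlgebraic (Algebra.adjoin R s) (F i)) : ¬ AlgebraicIndependent R F := by
  intro h
  have hle : (AlgebraicIndependent.matroid R A).eRk (Set.range F) ≤ s.encard := by
    refine le_trans ?_ ((AlgebraicIndependent.matroid R A).eRk_le_encard s)
    rw [← Matroid.eRk_closure_eq _ s]
    refine Matroid.eRk_mono _ ?_
    rw [AlgebraicIndependent.matroid_closure_eq]
    rintro _ ⟨i, rfl⟩
    exact hF i
  have hind : (AlgebraicIndependent.matroid R A).Indep (Set.range F) :=
    AlgebraicIndependent.matroid_indep_iff.2 h.to_subtype_range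
  have : Nontrivial R := (algebraMap R A).domain_nontrivial
  rw [hind.eRk_eq_encard, ← Set.image_univ, h.injective.encard_image, Set.encard_univ] at hle
  have := hle.trans hs
  simp at this
  exact absurd this (by norm_cast; omega)

/-- The elements of a finite quadratically closed set are differential algebraic: the set, `z` and
all derivatives lie in an algebra of finite transcendence degree which is closed under the
derivation. -/
lemma IsQuadraticallyClosed.differentialAlgebraic {R₀ R : Type*} [CommRing R₀] [CommRing R]
    [IsDomain R] [Algebra R₀ R] [FaithfulSMul R₀ R] [Algebra.IsAlgebraic R₀ R] {𝒴 : Set R⟦X⟧}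
    (h𝒴 : IsQuadraticallyClosed 𝒴) (hfin : 𝒴.Finite) {f : R⟦X⟧} (hf : f ∈ 𝒴) :
    DifferentialAlgebraic R₀ f := by
  obtain ⟨n, Y', hY'⟩ := hfin.fin_embedding
  let Y : Fin n → R⟦X⟧ := Y'
  have hY : Set.range Y = 𝒴 := hY'
  obtain ⟨q, g, hs⟩ := h𝒴.exists_system Y hY
  obtain ⟨d, e, hd, hde, hcl⟩ := exists_det_inverse_closed Y q g
    (fun i => (h𝒴 _ (hY ▸ Set.mem_range_self i)).1) hs
  set s : Set R⟦X⟧ := insert X (Set.range Y) with hsdef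
  -- constants from `R` are algebraic over `R₀`, so all of the closed algebra is algebraic over the
  -- algebra generated over `R₀` by the `n + 1` elements of `s`
  have hinj : Function.Injective (algebraMap R₀ R⟦X⟧) := by
    rw [IsScalarTower.algebraMap_eq R₀ R R⟦X⟧]
    exact (PowerSeries.C_injective (R := R)).comp (FaithfulSMul.algebraMap_injective R₀ R)
  have : FaithfulSMul R₀ R⟦X⟧ := (faithfulSMul_iff_algebraMap_injective _ _).2 hinj
  have : IsDomain R₀ := (FaithfulSMul.algebraMap_injective R₀ R).isDomain
  let K := Subalgebra.algebraicClosure (Algebra.adjoin R₀ s) R⟦X⟧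
  have hC : ∀ r : R, algebraMap R R⟦X⟧ r ∈ K := fun r =>
    ((Algebra.IsAlgebraic.isAlgebraic (R := R₀) r).algebraMap (A := R⟦X⟧)).extendScalars (by
      exact FaithfulSMul.algebraMap_injective R₀ (Algebra.adjoin R₀ s))
  let K' : Subalgebra R R⟦X⟧ := { K with algebraMap_mem' := hC }
  have hsK : s ⊆ K' := fun a ha => isAlgebraic_algebraMap
    (⟨a, Algebra.subset_adjoin ha⟩ : Algebra.adjoin R₀ s)
  have heK : e ∈ K' := by
    have hdK : IsAlgebraic (Algebra.adjoin R₀ s) d := Algebra.adjoin_le hsK hd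
    let : Invertible d := ⟨e, by rw [mul_comm]; exact hde, hde⟩
    exact hdK.invOf
  have hAK : Algebra.adjoin R (insert e s) ≤ K' :=
    Algebra.adjoin_le (Set.insert_subset heK hsK)
  have hXA : X ∈ Algebra.adjoin R (insert e s) := Algebra.subset_adjoin (Or.inr (Or.inl rfl))
  have hfA : ∀ i, (derivative R)^[i] f ∈ Algebra.adjoin R (insert e s) := by
    intro i
    induction i with
    | zero => exact Algebra.subset_adjoin (Or.inr (Or.inr (hY ▸ hf)))
    | succ i ih =>
      rw [Function.iterate_succ_apply']
      exact hcl _ ih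
  have hcard : s.encard ≤ ((n + 1 : ℕ) : ℕ∞) := by
    refine (Set.encard_insert_le _ _).trans ?_
    push_cast
    gcongr
    rw [← Set.image_univ]
    exact (Set.encard_image_le _ _).trans (by simp)
  have hdep := not_algebraicIndependent_of_algebraic_adjoin (R := R₀) s hcard
    (Fin.cons X fun i : Fin (n + 1) => (derivative R)^[(i : ℕ)] f)
    (fun i => by
      refine Fin.cases ?_ (fun i => ?_) i
      · exact hAK hXA
      · exact hAK (hfA i))
  rw [algebraicIndependent_iff] at hdep
  push Not at hdep
  obtain ⟨θ, hθ, hne⟩ := hdep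
  refine ⟨n, θ, fun c hc => hne ?_, hθ⟩
  rw [hc, MvPolynomial.aeval_C, map_eq_zero_iff _ hinj] at hθ
  rw [hc, hθ, MvPolynomial.C_0]

end QuadraticSystems

/-! ### Generating series -/

section GeneratingSeries

open PowerSeries

variable {R : Type*} [CommRing R] {α β : Type*}

/-- The generating series `∑ₐ wt a * z ^ size a`. It is meaningful if only finitely many elements
have any given size. -/
def genSeries (size : α → ℕ) (wt : α → R) : R⟦X⟧ :=
  PowerSeries.mk fun n => ∑ᶠ (a) (_ : size a = n), wt a

lemma coeff_genSeries {size : α → ℕ} (hfin : ∀ n, {a | size a = n}.Finite) (wt : α → R) (n : ℕ) :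
    coeff n (genSeries size wt) = ∑ a ∈ (hfin n).toFinset, wt a := by
  rw [genSeries, coeff_mk]
  exact finsum_mem_eq_finite_toFinset_sum wt (hfin n)

lemma genSeries_comp_equiv (e : α ≃ β) (size : β → ℕ) (wt : β → R) :
    genSeries (fun a => size (e a)) (fun a => wt (e a)) = genSeries size wt := by
  ext n
  simp only [genSeries, coeff_mk]
  exact finsum_comp_equiv e (f := fun b => ∑ᶠ (_ : size b = n), wt b)

lemma genSeries_sum {ι : Type*} (s : Finset ι) {size : α → ℕ}
    (hfin : ∀ n, {a | size a = n}.Finite) (wt : ι → α → R) :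
    genSeries size (fun a => ∑ i ∈ s, wt i a) = ∑ i ∈ s, genSeries size (wt i) := by
  ext n
  rw [map_sum, coeff_genSeries hfin, Finset.sum_comm]
  exact Finset.sum_congr rfl fun i _ => (coeff_genSeries hfin _ n).symm

lemma genSeries_const_mul {size : α → ℕ} (hfin : ∀ n, {a | size a = n}.Finite) (r : R)
    (wt : α → R) : genSeries size (fun a => r * wt a) = r • genSeries size wt := by
  ext n
  rw [map_smul, coeff_genSeries hfin, coeff_genSeries hfin, smul_eq_mul, Finset.mul_sum]

lemma genSeries_sumElim {size : α ⊕ β → ℕ} (hfin : ∀ n, {a | size a = n}.Finite) (wt : α ⊕ β → R) :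
    genSeries size wt = genSeries (fun a => size (Sum.inl a)) (fun a => wt (Sum.inl a)) +
      genSeries (fun b => size (Sum.inr b)) (fun b => wt (Sum.inr b)) := by
  classical
  have hα : ∀ n, {a | size (Sum.inl a) = n}.Finite := fun n =>
    (hfin n).preimage Sum.inl_injective.injOn
  have hβ : ∀ n, {b | size (Sum.inr b) = n}.Finite := fun n =>
    (hfin n).preimage Sum.inr_injective.injOn
  ext n
  rw [map_add, coeff_genSeries hfin, coeff_genSeries hα, coeff_genSeries hβ,
    ← Finset.sum_disjSum]
  refine Finset.sum_congr ?_ fun _ _ => rfl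
  ext (a | b) <;> simp

lemma genSeries_sigma {ι : Type*} [Fintype ι] {α : ι → Type*} {size : (Σ i, α i) → ℕ}
    (hfin : ∀ n, {a | size a = n}.Finite) (wt : (Σ i, α i) → R) :
    genSeries size wt = ∑ i, genSeries (fun a => size ⟨i, a⟩) (fun a => wt ⟨i, a⟩) := by
  classical
  have hα : ∀ i n, {a | size ⟨i, a⟩ = n}.Finite := fun i n =>
    (hfin n).preimage sigma_mk_injective.injOn
  ext n
  rw [map_sum, coeff_genSeries hfin]
  simp only [coeff_genSeries (hα _)]
  rw [← Finset.sum_sigma]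
  refine Finset.sum_congr ?_ fun _ _ => rfl
  ext ⟨i, a⟩
  simp

lemma genSeries_unique [Unique α] (size : α → ℕ) (wt : α → R) :
    genSeries size wt = C (wt default) * X ^ size default := by
  ext n
  rw [genSeries, coeff_mk, coeff_C_mul, coeff_X_pow, finsum_unique]
  by_cases h : size default = n
  · simp [h]
  · simp [h, Ne.symm h]

lemma finite_size_prod {size : α → ℕ} {size' : β → ℕ} (h : ∀ n, {a | size a = n}.Finite)
    (h' : ∀ n, {b | size' b = n}.Finite) (n : ℕ) :
    {p : α × β | size p.1 + size' p.2 = n}.Finite := by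
  refine ((Set.finite_Iic n).biUnion fun i _ => (Set.finite_Iic n).biUnion fun j _ =>
    (h i).prod (h' j)).subset ?_
  intro p hp
  simp only [Set.mem_ofPred_eq] at hp
  simp only [Set.mem_iUnion, Set.mem_prod, Set.mem_ofPred_eq, Set.mem_Iic]
  exact ⟨size p.1, by omega, size' p.2, by omega, rfl, rfl⟩

lemma genSeries_prod {size : α → ℕ} {size' : β → ℕ} (h : ∀ n, {a | size a = n}.Finite)
    (h' : ∀ n, {b | size' b = n}.Finite) (wt : α → R) (wt' : β → R) :
    genSeries (fun p : α × β => size p.1 + size' p.2) (fun p => wt p.1 * wt' p.2) =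
      genSeries size wt * genSeries size' wt' := by
  classical
  ext n
  rw [coeff_genSeries (finite_size_prod h h'), coeff_mul]
  simp only [coeff_genSeries h, coeff_genSeries h', Finset.sum_mul_sum]
  simp only [← Finset.sum_product']
  rw [← Finset.sum_biUnion]
  · refine Finset.sum_congr ?_ fun _ _ => rfl
    ext p
    simp
  · intro i _ j _ hij
    refine Finset.disjoint_left.2 fun p hp hp' => hij ?_
    simp only [Finset.mem_product, Set.Finite.mem_toFinset, Set.mem_ofPred_eq] at hp hp'
    exact Prod.ext (hp.1.symm.trans hp'.1) (hp.2.symm.trans hp'.2)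

/-- The Euler derivation multiplies the weights by the sizes. -/
lemma X_mul_derivative_genSeries {size : α → ℕ} (h : ∀ n, {a | size a = n}.Finite) (wt : α → R) :
    X * derivative R (genSeries size wt) = genSeries size (fun a => (size a : R) * wt a) := by
  ext n
  rw [coeff_genSeries h]
  have h1 : ∑ a ∈ (h n).toFinset, (size a : R) * wt a = n * coeff n (genSeries size wt) := by
    rw [coeff_genSeries h, Finset.mul_sum]
    refine Finset.sum_congr rfl fun a ha => ?_
    rw [Set.Finite.mem_toFinset] at ha
    rw [ha]
  rw [h1]
  rcases n with _ | n
  · simp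
  · rw [coeff_succ_X_mul, coeff_derivative, mul_comm]
    push_cast
    ring

lemma constantCoeff_genSeries {size : α → ℕ} (h : ∀ a, size a ≠ 0) (wt : α → R) :
    constantCoeff (genSeries size wt) = 0 := by
  rw [genSeries, ← coeff_zero_eq_constantCoeff_apply, coeff_mk]
  simp [h]

end GeneratingSeries

/-! ### Sizes and weights of planar trees -/

section Trees

variable {Υ : Type*} {ar : Υ → ℕ} {L : Type*}

namespace OpTree

lemma arity_pos (har : ∀ v, 2 ≤ ar v) (t : OpTree ar L) : 0 < t.arity := by
  induction t with
  | leaf x => exact Nat.one_pos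
  | node v c ih =>
    rw [arity]
    exact Finset.sum_pos (fun i _ => ih i) ⟨⟨0, by have := har v; omega⟩, Finset.mem_univ _⟩

lemma arity_child_lt (har : ∀ v, 2 ≤ ar v) {v : Υ} (c : Fin (ar v) → OpTree ar L)
    (i : Fin (ar v)) : (c i).arity < (node v c).arity := by
  have : Nontrivial (Fin (ar v)) := Fin.nontrivial_iff_two_le.2 (har v)
  obtain ⟨j, hj⟩ := exists_ne i
  rw [arity]
  exact Finset.single_lt_sum (f := fun i => (c i).arity) hj (Finset.mem_univ i)
    (Finset.mem_univ j) (arity_pos har _) fun _ _ _ => Nat.zero_le _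

/-- This needs vertices with at least two inputs: unary vertices do not change the arity. -/
lemma finite_arity_eq [Finite Υ] [Finite L] (har : ∀ v, 2 ≤ ar v) (n : ℕ) :
    {t : OpTree ar L | t.arity = n}.Finite := by
  induction n using Nat.strong_induction_on with
  | _ n ih =>
    have hlt : {t : OpTree ar L | t.arity < n}.Finite :=
      ((Set.finite_Iio n).biUnion fun m hm => ih m hm).subset fun t ht => by
        simpa using ht
    refine ((Set.finite_range leaf).union (Set.finite_iUnion fun v =>
      (Set.Finite.pi' fun _ : Fin (ar v) => hlt).image (node v))).subset ?_
    rintro (x | ⟨v, c⟩) ht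
    · exact Or.inl ⟨x, rfl⟩
    · refine Or.inr (Set.mem_iUnion.2 ⟨v, c, fun i => ?_, rfl⟩)
      exact (arity_child_lt har c i).trans_eq ht

lemma finite_sum_arity_eq [Finite Υ] [Finite L] (har : ∀ v, 2 ≤ ar v) (m n : ℕ) :
    {c : Fin m → OpTree ar L | ∑ i, (c i).arity = n}.Finite := by
  have hle : {t : OpTree ar L | t.arity ≤ n}.Finite :=
    ((Set.finite_Iic n).biUnion fun m _ => finite_arity_eq har m).subset fun t ht => by
      simpa using ht
  refine (Set.Finite.pi' fun _ : Fin m => hle).subset fun c hc i => ?_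
  exact (Finset.single_le_sum (fun i _ => Nat.zero_le (c i).arity) (Finset.mem_univ i)).trans_eq hc

end OpTree

/-- For numbers `a₁, …, aₘ`, the product of the fractions `aᵢ / (aᵢ + ⋯ + aₘ)`: the probability
that the minima of disjoint random blocks of these sizes are increasing. -/
def hookFactor : {m : ℕ} → (Fin m → ℕ) → ℚ
  | 0, _ => 1
  | _ + 1, a => (a 0 : ℚ) / (∑ i, a i : ℕ) * hookFactor (Fin.tail a)

/-- The proportion of the shuffle labellings among all labellings of a planar tree, given by its
hook type formula; `ncard_shuffleMonomial_skeleton` proves that it has this meaning. -/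
def OpTree.shuffleDensity : OpTree ar L → ℚ
  | leaf _ => 1
  | node _ c => hookFactor (fun i => (c i).arity) * ∏ i, (c i).shuffleDensity

/-- The product of the weights of the vertices of a tree. -/
def OpTree.weight {R : Type*} [CommRing R] (w : Υ → R) : OpTree ar L → R
  | leaf _ => 1
  | node v c => w v * ∏ i, (c i).weight w

/-- A planar tree is a leaf or a vertex with a tuple of planar trees. -/
def OpTree.equivSum (ar : Υ → ℕ) :
    OpTree ar Unit ≃ Unit ⊕ (Σ v, Fin (ar v) → OpTree ar Unit) where
  toFun
    | leaf _ => Sum.inl ()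
    | node v c => Sum.inr ⟨v, c⟩
  invFun
    | Sum.inl _ => leaf ()
    | Sum.inr p => node p.1 p.2
  left_inv := by rintro (_ | _) <;> rfl
  right_inv := by rintro (_ | _) <;> rfl

end Trees

/-! ### The quadratic system of a tree automaton -/

section Automaton

open PowerSeries OpTree

variable {Υ : Type*} {ar : Υ → ℕ} {R : Type*} [CommRing R]

lemma genSeries_arity [Fintype Υ] (har : ∀ v, 2 ≤ ar v) (wt : OpTree ar Unit → R) :
    genSeries arity wt = C (wt (leaf ())) * X + ∑ v : Υ,
      genSeries (fun c : Fin (ar v) → OpTree ar Unit => ∑ i, (c i).arity)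
        (fun c => wt (node v c)) := by
  rw [← genSeries_comp_equiv (equivSum ar).symm]
  have hfin : ∀ n, {a | ((equivSum ar).symm a).arity = n}.Finite := fun n =>
    (finite_arity_eq har n).preimage (equivSum ar).symm.injective.injOn
  have hfin' : ∀ n, {a | ((equivSum ar).symm (Sum.inr a)).arity = n}.Finite := fun n =>
    (hfin n).preimage Sum.inr_injective.injOn
  rw [genSeries_sumElim hfin, genSeries_unique, genSeries_sigma hfin']
  congr 1
  simp [equivSum, arity]

variable [Algebra ℚ R]

/-- The exponential generating series of shuffle tuples of planar trees, weighted by the product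
of `u i (c i)` for the tuple `c`. The shuffle densities of the single trees are part of the weights
`u i`; the factor `hookFactor` accounts for the order of the trees of the tuple. -/
def forestSeries {m : ℕ} (u : Fin m → OpTree ar Unit → R) : R⟦X⟧ :=
  genSeries (fun c : Fin m → OpTree ar Unit => ∑ i, (c i).arity)
    fun c => hookFactor (fun i => (c i).arity) • ∏ i, u i (c i)

lemma forestSeries_zero (u : Fin 0 → OpTree ar Unit → R) : forestSeries u = 1 := by
  rw [forestSeries, genSeries_unique]
  simp [hookFactor]

/-- In a shuffle tuple of trees the minimum of all labels lies in the first tree; removing it is the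
derivation. -/
lemma derivative_forestSeries_succ [Finite Υ] (har : ∀ v, 2 ≤ ar v) {m : ℕ}
    (u : Fin (m + 1) → OpTree ar Unit → R) :
    derivative R (forestSeries u) =
      derivative R (genSeries arity (u 0)) * forestSeries (Fin.tail u) := by
  have hX : Function.Injective fun f : R⟦X⟧ => X * f := fun f g h => X_mul_cancel h
  apply hX
  change X * _ = X * _
  rw [← mul_assoc, X_mul_derivative_genSeries (finite_arity_eq har), forestSeries, forestSeries,
    X_mul_derivative_genSeries (finite_sum_arity_eq har (m + 1)),
    ← genSeries_prod (finite_arity_eq har) (finite_sum_arity_eq har m),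
    ← genSeries_comp_equiv (Fin.consEquiv fun _ : Fin (m + 1) => OpTree ar Unit)]
  congr 1
  · funext p
    simp [Fin.consEquiv, Fin.sum_univ_succ]
  · funext p
    have hpos : 0 < p.1.arity := arity_pos har _
    simp only [Fin.consEquiv, Equiv.coe_fn_mk, hookFactor, Fin.sum_univ_succ, Fin.cons_zero,
      Fin.cons_succ, Fin.prod_univ_succ, Fin.tail_def]
    rw [← nsmul_eq_mul, ← nsmul_eq_mul, ← Nat.cast_smul_eq_nsmul ℚ, ← Nat.cast_smul_eq_nsmul ℚ,
      smul_smul, smul_mul_smul_comm]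
    congr 1
    have : ((p.1.arity + ∑ i, (p.2 i).arity : ℕ) : ℚ) ≠ 0 := by
      have : 0 < p.1.arity + ∑ i, (p.2 i).arity := by omega
      positivity
    field_simp

/-- A finite bottom-up tree automaton yields a finite quadratically closed set of series: those of
the states and of the tuples of states. -/
theorem exists_quadraticallyClosed [Finite Υ] (har : ∀ v, 2 ≤ ar v) (w : Υ → R) {A : Type*}
    [Finite A] (σ : OpTree ar Unit → A)
    (hσ : ∀ v (c c' : Fin (ar v) → OpTree ar Unit), (∀ i, σ (c i) = σ (c' i)) →
      σ (node v c) = σ (node v c')) (p : A → Prop) [DecidablePred p] :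
    ∃ 𝒴 : Set R⟦X⟧, 𝒴.Finite ∧ IsQuadraticallyClosed 𝒴 ∧
      genSeries arity (fun t : OpTree ar Unit =>
        if p (σ t) then t.shuffleDensity • t.weight w else 0) ∈ 𝒴 := by
  classical
  cases nonempty_fintype Υ
  cases nonempty_fintype A
  -- `U a` and `y a` are the weights and the series of a state, `Z b` is the series of a tuple of
  -- states
  let U : A → OpTree ar Unit → R := fun a t =>
    if σ t = a then t.shuffleDensity • t.weight w else 0
  let y : A → R⟦X⟧ := fun a => genSeries arity (U a)
  let Z : ∀ {m : ℕ}, (Fin m → A) → R⟦X⟧ := fun b => forestSeries fun i => U (b i)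
  let E : R⟦X⟧ := genSeries arity (fun t : OpTree ar Unit =>
        if p (σ t) then t.shuffleDensity • t.weight w else 0)
  have hE : E = ∑ a ∈ Finset.univ.filter p, y a := by
    rw [← genSeries_sum _ (finite_arity_eq har)]
    refine congrArg (genSeries arity) (funext fun t => ?_)
    simp [U]
  -- `hσ` makes the state at a vertex a function of the states above it; the value of `step` on
  -- tuples which are not tuples of states of trees is arbitrary, as their series vanish
  let step : ∀ v, (Fin (ar v) → A) → A := fun v =>
    Function.extend (fun c i => σ (c i)) (fun c => σ (node v c)) (fun _ => σ (leaf ()))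
  have hstep : ∀ v (c : Fin (ar v) → OpTree ar Unit),
      step v (fun i => σ (c i)) = σ (node v c) := fun v c =>
    Function.FactorsThrough.extend_apply
      (f := fun (c : Fin (ar v) → OpTree ar Unit) i => σ (c i))
      (fun c c' h => hσ v c c' (congrFun h)) _ c
  have hy : ∀ a, y a = C (U a (leaf ())) * X + ∑ v, ∑ b : Fin (ar v) → A,
      (if step v b = a then w v else 0) • Z b := by
    intro a
    rw [show y a = genSeries arity (U a) from rfl, genSeries_arity har]
    congr 1
    refine Finset.sum_congr rfl fun v _ => ?_
    simp only [Z, forestSeries]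
    simp only [← genSeries_const_mul (finite_sum_arity_eq har (ar v))]
    rw [← genSeries_sum _ (finite_sum_arity_eq har (ar v))]
    congr 1
    funext c
    -- only the tuple of the states of the trees `c i` contributes to the sum over `b`
    rw [Finset.sum_eq_single fun i => σ (c i)]
    · simp only [U, hstep, if_true, shuffleDensity, OpTree.weight]
      split_ifs
      · rw [Finset.prod_smul, mul_smul, mul_smul_comm, mul_smul_comm, smul_comm]
      · rw [zero_mul]
    · intro b _ hb
      obtain ⟨i, hi⟩ := Function.ne_iff.1 hb
      rw [Finset.prod_eq_zero (Finset.mem_univ i) (if_neg hi.symm), smul_zero, mul_zero]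
    · intro h
      exact absurd (Finset.mem_univ _) h
  obtain ⟨M, hM⟩ := (Set.finite_range ar).bddAbove
  let 𝒴 : Set R⟦X⟧ := insert E (Set.range y ∪ ⋃ m ∈ Set.Icc 1 M, Set.range (Z (m := m)))
  let V := Submodule.span R (insert 1 {h | ∃ a ∈ 𝒴, ∃ b ∈ 𝒴, h = a * derivative R b})
  have hy𝒴 : ∀ a, y a ∈ 𝒴 := fun a => Or.inr (Or.inl ⟨a, rfl⟩)
  have hZ𝒴 : ∀ {m : ℕ} (b : Fin m → A), 1 ≤ m → m ≤ M → Z b ∈ 𝒴 := fun {m} b h1 h2 =>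
    Or.inr (Or.inr (Set.mem_biUnion (show m ∈ Set.Icc 1 M from ⟨h1, h2⟩) ⟨b, rfl⟩))
  have hZV : ∀ {m : ℕ} (b : Fin m → A), 2 ≤ m → m ≤ M → derivative R (Z b) ∈ V := by
    intro m b h1 h2
    obtain ⟨m, rfl⟩ : ∃ k, m = k + 1 := ⟨m - 1, by omega⟩
    refine Submodule.subset_span (Or.inr ⟨Z (Fin.tail b), hZ𝒴 _ (by omega) (by omega),
      y (b 0), hy𝒴 _, ?_⟩)
    rw [mul_comm]
    exact derivative_forestSeries_succ har _
  have hyV : ∀ a, derivative R (y a) ∈ V := by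
    intro a
    rw [hy a, map_add, map_sum]
    refine add_mem ?_ (sum_mem fun v _ => ?_)
    · rw [← PowerSeries.smul_eq_C_mul, Derivation.map_smul, derivative_X]
      exact Submodule.smul_mem _ _ (Submodule.subset_span (Or.inl rfl))
    · rw [map_sum]
      refine sum_mem fun b _ => ?_
      rw [Derivation.map_smul]
      exact Submodule.smul_mem _ _ (hZV b (har v) (hM ⟨v, rfl⟩))
  refine ⟨𝒴, ?_, ?_, Or.inl rfl⟩
  · exact ((Set.finite_range y).union ((Set.finite_Icc 1 M).biUnion fun m _ =>
      Set.finite_range _)).insert E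
  · rintro f (rfl | ⟨a, rfl⟩ | hf)
    · refine ⟨constantCoeff_genSeries (fun t => (arity_pos har t).ne') _, ?_⟩
      rw [hE, map_sum]
      exact sum_mem fun a _ => hyV a
    · exact ⟨constantCoeff_genSeries (fun t => (arity_pos har t).ne') _, hyV a⟩
    · simp only [Set.mem_iUnion] at hf
      obtain ⟨m, ⟨h1, h2⟩, b, rfl⟩ := hf
      refine ⟨constantCoeff_genSeries (fun c => ?_) _, ?_⟩
      · exact (Finset.sum_pos (fun i _ => arity_pos har (c i))
          ⟨⟨0, h1⟩, Finset.mem_univ _⟩).ne'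
      · -- the series of a one-element tuple is that of its state
        rcases Nat.lt_or_ge m 2 with h | h
        · obtain rfl : m = 1 := by omega
          have : derivative R (Z b) = derivative R (y (b 0)) := by
            rw [show derivative R (Z b) = _ from derivative_forestSeries_succ har _,
              forestSeries_zero, mul_one]
          rw [this]
          exact hyV _
        · exact hZV b h h2

end Automaton

/-! ### Leaves of planar trees -/

namespace OpTree

variable {Υ : Type*} {ar : Υ → ℕ} {L M : Type*}

/-- Different leaves have different labels, in a form that is recursive in the tree. -/
def LeavesDisjoint : OpTree ar L → Prop
  | leaf _ => True
  | node _ c => (Pairwise fun i j => Disjoint (c i).leaves (c j).leaves) ∧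
      ∀ i, (c i).LeavesDisjoint

lemma range_label (t : OpTree ar L) : Set.range t.label = t.leaves := by
  induction t with
  | leaf x =>
    have : Nonempty (Fin (arity (leaf x : OpTree ar L))) := ⟨⟨0, Nat.one_pos⟩⟩
    exact Set.range_const
  | node v c ih =>
    simp only [leaves, ← ih]
    ext x
    simp only [Set.mem_range, Set.mem_iUnion]
    constructor
    · rintro ⟨p, rfl⟩
      exact ⟨_, _, rfl⟩
    · rintro ⟨i, j, rfl⟩
      refine ⟨blockEquiv (fun i => (c i).arity) ⟨i, j⟩, ?_⟩
      simp only [label]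
      rw [Equiv.symm_apply_apply]

lemma label_injective_iff (t : OpTree ar L) : Function.Injective t.label ↔ t.LeavesDisjoint := by
  induction t with
  | leaf x =>
    refine iff_of_true (fun p q _ => ?_) trivial
    have : Subsingleton (Fin (arity (leaf x : OpTree ar L))) :=
      inferInstanceAs (Subsingleton (Fin 1))
    exact Subsingleton.elim p q
  | node v c ih =>
    refine ((blockEquiv fun i => (c i).arity).symm.injective_comp
      fun q : Σ i, Fin (c i).arity => (c q.1).label q.2).trans ?_
    rw [LeavesDisjoint]
    simp only [← ih, ← range_label]
    constructor
    · intro h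
      refine ⟨fun i j hij => Set.disjoint_left.2 ?_, fun i p q hpq => ?_⟩
      · rintro _ ⟨p, rfl⟩ ⟨q, hq⟩
        exact hij (congrArg Sigma.fst (@h ⟨j, q⟩ ⟨i, p⟩ hq)).symm
      · exact eq_of_heq (Sigma.mk.inj (@h ⟨i, p⟩ ⟨i, q⟩ hpq)).2
    · rintro ⟨h1, h2⟩ ⟨i, p⟩ ⟨j, q⟩ hpq
      obtain rfl : i = j := by
        by_contra hij
        exact Set.disjoint_left.1 (h1 hij) ⟨p, rfl⟩ ⟨q, hpq.symm⟩
      exact congrArg (Sigma.mk i) (h2 i hpq)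

lemma label_bijective_iff (t : OpTree ar L) :
    Function.Bijective t.label ↔ t.LeavesDisjoint ∧ t.leaves = Set.univ := by
  rw [Function.Bijective, label_injective_iff, ← range_label, Set.range_eq_univ]

lemma ncard_leaves {t : OpTree ar L} (h : t.LeavesDisjoint) : t.leaves.ncard = t.arity := by
  rw [← range_label, Set.ncard_range_of_injective ((label_injective_iff t).2 h), Nat.card_fin]

lemma finite_leaves (t : OpTree ar L) : t.leaves.Finite :=
  t.range_label ▸ Set.finite_range _

lemma leaves_nonempty (har : ∀ v, 2 ≤ ar v) (t : OpTree ar L) : t.leaves.Nonempty := by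
  rw [← range_label]
  have : Nonempty (Fin t.arity) := ⟨⟨0, arity_pos har t⟩⟩
  exact Set.range_nonempty _

lemma leaves_bind (t : OpTree ar L) (f : L → OpTree ar M) :
    (t.bind f).leaves = ⋃ x ∈ t.leaves, (f x).leaves := by
  induction t with
  | leaf x => simp [bind, leaves]
  | node v c ih =>
    simp only [bind, leaves, ih]
    ext y
    simp only [Set.mem_iUnion]
    constructor
    · rintro ⟨i, x, hx, hy⟩
      exact ⟨x, ⟨i, hx⟩, hy⟩
    · rintro ⟨x, ⟨i, hx⟩, hy⟩
      exact ⟨i, x, hx, hy⟩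

lemma leaves_relabel (f : L → M) (t : OpTree ar L) : (t.relabel f).leaves = f '' t.leaves := by
  rw [relabel, leaves_bind]
  ext y
  simp [leaves, eq_comm]

lemma arity_relabel (f : L → M) (t : OpTree ar L) : (t.relabel f).arity = t.arity := by
  induction t with
  | leaf x => rfl
  | node v c ih => exact Finset.sum_congr rfl fun i _ => ih i

lemma arity_skeleton (t : OpTree ar L) : t.skeleton.arity = t.arity := arity_relabel _ t

lemma skeleton_node (v : Υ) (c : Fin (ar v) → OpTree ar L) :
    (node v c).skeleton = node v fun i => (c i).skeleton := rfl

lemma bind_bind {N : Type*} (t : OpTree ar L) (f : L → OpTree ar M) (g : M → OpTree ar N) :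
    (t.bind f).bind g = t.bind fun x => (f x).bind g := by
  induction t with
  | leaf x => rfl
  | node v c ih => exact congrArg (node v) (funext ih)

lemma skeleton_relabel (f : L → M) (t : OpTree ar L) : (t.relabel f).skeleton = t.skeleton := by
  rw [skeleton, relabel, relabel, bind_bind]
  rfl

lemma skeleton_bind (f : L → OpTree ar M) (t : OpTree ar L) :
    (t.bind f).skeleton = t.bind fun x => (f x).skeleton := by
  rw [skeleton, relabel, bind_bind]
  rfl

end OpTree

/-! ### Counting shuffle labellings -/

section Counting

open OpTree

variable {Υ : Type*} {ar : Υ → ℕ} {L : Type*} [LinearOrder L]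

/-- The shuffle trees with given skeleton and given set of labels, each label occurring once. -/
def shuffleLabellings (s : OpTree ar Unit) (X : Finset L) : Set (OpTree ar L) :=
  {t | t.skeleton = s ∧ t.IsShuffle ∧ t.LeavesDisjoint ∧ t.leaves = X}

/-- The tuples of shuffle trees with given skeletons whose labels are distinct and form a given set,
and which are ordered by their minimal labels. -/
def shuffleForests {m : ℕ} (c : Fin m → OpTree ar Unit) (X : Finset L) :
    Set (Fin m → OpTree ar L) :=
  {t | (∀ i, (t i).skeleton = c i) ∧ (∀ i, (t i).IsShuffle) ∧ (∀ i, (t i).LeavesDisjoint) ∧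
    (∀ i j, i < j → MinLT (t i) (t j)) ∧
    (Pairwise fun i j => Disjoint (t i).leaves (t j).leaves) ∧ ⋃ i, (t i).leaves = X}

lemma shuffleLabellings_node (v : Υ) (c : Fin (ar v) → OpTree ar Unit) (X : Finset L) :
    shuffleLabellings (node v c) X = node v '' shuffleForests c X := by
  ext t
  constructor
  · rintro ⟨h1, h2, h3, h4⟩
    cases t with
    | leaf x => cases h1
    | node v' c' =>
      rw [skeleton_node] at h1
      injection h1 with hv hc
      subst hv
      exact ⟨c', ⟨congrFun (eq_of_heq hc), h2.2, h3.2, h2.1, h3.1, h4⟩, rfl⟩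
  · rintro ⟨t, ⟨h1, h2, h3, h4, h5, h6⟩, rfl⟩
    exact ⟨by rw [skeleton_node, funext h1], ⟨h4, h2⟩, ⟨h5, h3⟩, h6⟩

/-- The first tree of a shuffle tuple carries the smallest label and an arbitrary set `Y` of further
labels. -/
lemma shuffleForests_succ {m : ℕ} (c : Fin (m + 1) → OpTree ar Unit)
    {X : Finset L} {x₀ : L} (h₀ : x₀ ∈ X) (hmin : ∀ x ∈ X, x₀ ≤ x) :
    shuffleForests c X = ⋃ Y ∈ ((X.erase x₀).powersetCard ((c 0).arity - 1) : Set (Finset L)),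
      (fun p : OpTree ar L × (Fin m → OpTree ar L) => (Fin.cons p.1 p.2 : Fin (m + 1) → _)) ''
        (shuffleLabellings (c 0) (insert x₀ Y) ×ˢ
          shuffleForests (Fin.tail c) (X.erase x₀ \ Y)) := by
  ext t
  simp only [Set.mem_iUnion]
  constructor
  · rintro ⟨h1, h2, h3, h4, h5, h6⟩
    have hx₀ : x₀ ∈ (t 0).leaves := by
      have : x₀ ∈ ⋃ i, (t i).leaves := by rw [h6]; exact h₀
      obtain ⟨j, hj⟩ := Set.mem_iUnion.1 this
      rcases Fin.eq_zero_or_eq_succ j with rfl | ⟨i, rfl⟩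
      · exact hj
      · obtain ⟨x, hx, hlt⟩ := h4 0 i.succ (Fin.succ_pos i)
        have hxX : x ∈ (X : Set L) := h6 ▸ Set.mem_iUnion.2 ⟨0, hx⟩
        exact absurd (hlt _ hj) (not_lt.2 (hmin x hxX))
    have hfin := finite_leaves (t 0)
    have hins : insert x₀ (hfin.toFinset.erase x₀) = hfin.toFinset :=
      Finset.insert_erase (hfin.mem_toFinset.2 hx₀)
    have hcard : hfin.toFinset.card = (c 0).arity := by
      rw [← Set.ncard_eq_toFinset_card _ hfin, ncard_leaves (h3 0), ← h1 0, arity_skeleton]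
    have hmem : ∀ x, x ∈ X ↔ ∃ i, x ∈ (t i).leaves := fun x => by
      rw [← Finset.mem_coe, ← h6, Set.mem_iUnion]
    refine ⟨hfin.toFinset.erase x₀, ?_, ⟨t 0, Fin.tail t⟩, ⟨⟨h1 0, h2 0, h3 0, ?_⟩,
      fun i => h1 i.succ, fun i => h2 i.succ, fun i => h3 i.succ,
      fun i j hij => h4 _ _ (Fin.succ_lt_succ_iff.2 hij),
      fun i j hij => h5 ((Fin.succ_injective m).ne hij), ?_⟩, Fin.cons_self_tail t⟩
    · rw [Finset.mem_coe, Finset.mem_powersetCard,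
        Finset.card_erase_of_mem (hfin.mem_toFinset.2 hx₀), hcard]
      refine ⟨Finset.erase_subset_erase _ fun x hx => ?_, rfl⟩
      exact (hmem x).2 ⟨0, hfin.mem_toFinset.1 hx⟩
    · rw [hins, Set.Finite.coe_toFinset]
    · ext x
      simp only [Set.mem_iUnion, Finset.mem_coe, Finset.mem_sdiff, Finset.mem_erase,
        Set.Finite.mem_toFinset, hmem, Fin.tail]
      constructor
      · rintro ⟨i, hi⟩
        have hx0 : x ∉ (t 0).leaves := fun h =>
          Set.disjoint_left.1 (h5 (Fin.succ_ne_zero i)) hi h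
        exact ⟨⟨fun h => hx0 (h ▸ hx₀), _, hi⟩, fun h => hx0 h.2⟩
      · rintro ⟨⟨hne, j, hj⟩, hn⟩
        rcases Fin.eq_zero_or_eq_succ j with rfl | ⟨i, rfl⟩
        · exact absurd ⟨hne, hj⟩ hn
        · exact ⟨i, hj⟩
  · rintro ⟨Y, hY, ⟨t₀, t⟩, ⟨⟨h1, h2, h3, h4⟩, g1, g2, g3, g4, g5, g6⟩, rfl⟩
    have hYX := (Finset.mem_powersetCard.1 hY).1
    have hrest : ∀ i x, x ∈ (t i).leaves → x ∈ X.erase x₀ \ Y := fun i x hx => by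
      rw [← Finset.mem_coe, ← g6]
      exact Set.mem_iUnion.2 ⟨i, hx⟩
    have hdisj : ∀ i, Disjoint t₀.leaves (t i).leaves := fun i => by
      refine Set.disjoint_left.2 fun x hx hx' => ?_
      have := hrest i x hx'
      simp only [h4, Finset.mem_coe, Finset.mem_insert] at hx
      simp only [Finset.mem_sdiff, Finset.mem_erase] at this
      tauto
    refine ⟨Fin.cases h1 g1, Fin.cases h2 g2, Fin.cases h3 g3, ?_, ?_, ?_⟩
    · intro i j hij
      rcases Fin.eq_zero_or_eq_succ j with rfl | ⟨j, rfl⟩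
      · exact absurd hij (Fin.not_lt_zero i)
      rcases Fin.eq_zero_or_eq_succ i with rfl | ⟨i, rfl⟩
      · refine ⟨x₀, ?_, fun y hy => ?_⟩
        · change x₀ ∈ t₀.leaves
          rw [h4]
          exact Finset.mem_insert_self _ _
        · have := (Finset.mem_sdiff.1 (hrest j y hy)).1
          exact lt_of_le_of_ne (hmin y (Finset.mem_of_mem_erase this))
            (Finset.ne_of_mem_erase this).symm
      · exact g4 i j (Fin.succ_lt_succ_iff.1 hij)
    · intro i j hij
      rcases Fin.eq_zero_or_eq_succ i with rfl | ⟨i, rfl⟩ <;>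
        rcases Fin.eq_zero_or_eq_succ j with rfl | ⟨j, rfl⟩
      · exact absurd rfl hij
      · exact hdisj j
      · exact (hdisj i).symm
      · exact g5 fun h => hij (congrArg Fin.succ h)
    · ext x
      have hx : x ∈ Y → x ≠ x₀ ∧ x ∈ X := fun h => Finset.mem_erase.1 (hYX h)
      rw [Set.mem_iUnion, Fin.exists_fin_succ]
      simp only [Fin.cons_zero, Fin.cons_succ, ← Set.mem_iUnion, g6, h4, Finset.mem_coe,
        Finset.mem_insert, Finset.mem_sdiff, Finset.mem_erase]
      by_cases hxe : x = x₀
      · simp [hxe, h₀]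
      · tauto

lemma finite_shuffleLabellings [Finite Υ] [Finite L] (har : ∀ v, 2 ≤ ar v) (s : OpTree ar Unit)
    (X : Finset L) : (shuffleLabellings s X).Finite :=
  (finite_arity_eq har s.arity).subset fun t ht => by
    rw [Set.mem_ofPred_eq, ← ht.1, arity_skeleton]

lemma finite_shuffleForests [Finite Υ] [Finite L] (har : ∀ v, 2 ≤ ar v) {m : ℕ}
    (c : Fin m → OpTree ar Unit) (X : Finset L) : (shuffleForests c X).Finite :=
  (Set.Finite.pi' fun i => finite_arity_eq har (c i).arity).subset fun t ht i => by
    rw [Set.mem_ofPred_eq, ← ht.1 i, arity_skeleton]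

/-- The numbers of choices `(a + b).choose a` of the labels of the first tree, with `a + 1` leaves
of `a + b + 1`, account for the factors of `hookFactor`. -/
lemma ncard_shuffleForests [Finite Υ] [Finite L] (har : ∀ v, 2 ≤ ar v) {m : ℕ}
    (c : Fin m → OpTree ar Unit)
    (hc : ∀ (i) (X : Finset L), X.card = (c i).arity →
      ((shuffleLabellings (c i) X).ncard : ℚ) = (c i).arity.factorial * (c i).shuffleDensity)
    (X : Finset L) (hX : X.card = ∑ i, (c i).arity) :
    ((shuffleForests c X).ncard : ℚ) =
      X.card.factorial * (hookFactor (fun i => (c i).arity) * ∏ i, (c i).shuffleDensity) := by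
  induction m generalizing X with
  | zero =>
    obtain rfl : X = ∅ := by simpa using hX
    have : shuffleForests c (∅ : Finset L) = Set.univ := by
      ext t
      simp [shuffleForests, Subsingleton.pairwise]
    rw [this]
    simp [hookFactor, Set.ncard_univ]
  | succ m ih =>
    have hpos : 0 < (c 0).arity := arity_pos har _
    obtain ⟨a, ha⟩ : ∃ a, (c 0).arity = a + 1 := ⟨_, (Nat.succ_pred hpos.ne').symm⟩
    have hXs := hX
    rw [Fin.sum_univ_succ, ha] at hX
    have hne : X.Nonempty := Finset.card_pos.1 (by omega)
    have h₀ : X.min' hne ∈ X := X.min'_mem hne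
    set x₀ := X.min' hne with hx₀
    set b := ∑ i : Fin m, (c i.succ).arity with hb
    have hcX : (X.erase x₀).card = a + b := by
      rw [Finset.card_erase_of_mem h₀]
      omega
    have hterm : ∀ Y ∈ (X.erase x₀).powersetCard a,
        (((fun p : OpTree ar L × (Fin m → OpTree ar L) => (Fin.cons p.1 p.2 : Fin (m + 1) → _)) ''
        (shuffleLabellings (c 0) (insert x₀ Y) ×ˢ
          shuffleForests (Fin.tail c) (X.erase x₀ \ Y))).ncard : ℚ) =
        ((a + 1).factorial * (c 0).shuffleDensity) * (b.factorial *
          (hookFactor (fun i => (Fin.tail c i).arity) * ∏ i, (Fin.tail c i).shuffleDensity)) := by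
      intro Y hY
      obtain ⟨hYs, hYc⟩ := Finset.mem_powersetCard.1 hY
      have hx₀Y : x₀ ∉ Y := fun h => Finset.notMem_erase _ _ (hYs h)
      have hrc : (X.erase x₀ \ Y).card = b := by
        rw [Finset.card_sdiff_of_subset hYs]
        omega
      rw [Set.ncard_image_of_injective _ (fun p q h => by
        obtain ⟨h1, h2⟩ := Fin.cons_inj.1 h
        exact Prod.ext h1 h2), Set.ncard_prod, Nat.cast_mul, hc 0 _ (by
          rw [Finset.card_insert_of_notMem hx₀Y, hYc, ha]),
        ih (Fin.tail c) (fun i => hc i.succ) _ hrc, hrc, ha]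
    rw [shuffleForests_succ c h₀ (fun x hx => X.min'_le x hx), ha, Nat.add_sub_cancel]
    rw [Set.Finite.ncard_biUnion (Finset.finite_toSet _)]
    · rw [finsum_mem_coe_finset, Nat.cast_sum, Finset.sum_congr rfl hterm, Finset.sum_const,
        Finset.card_powersetCard, hcX, nsmul_eq_mul, show X.card = a + b + 1 by omega, hookFactor,
        ← hXs, show X.card = a + b + 1 by omega, ha, Fin.prod_univ_succ, Nat.factorial_succ (a + b),
        ← Nat.add_choose_mul_factorial_mul_factorial a b, Nat.factorial_succ a]
      push_cast
      have : (a + b + 1 : ℚ) ≠ 0 := by positivity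
      simp only [Fin.tail_def]
      field_simp
      rw [Nat.choose_symm_add]
      ring
    · exact fun Y _ => ((finite_shuffleLabellings har _ _).prod
        (finite_shuffleForests har _ _)).image _
    · intro Y hY Y' hY' hne'
      refine Set.disjoint_left.2 ?_
      rintro _ ⟨⟨t₀, t⟩, ⟨⟨-, -, -, h⟩, -⟩, rfl⟩ ⟨⟨t₀', t'⟩, ⟨⟨-, -, -, h'⟩, -⟩, e⟩
      obtain ⟨rfl, -⟩ := Fin.cons_inj.1 e
      have hYs := (Finset.mem_powersetCard.1 hY).1
      have hYs' := (Finset.mem_powersetCard.1 hY').1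
      have hins : insert x₀ Y = insert x₀ Y' := Finset.coe_injective (h.symm.trans h')
      refine hne' ?_
      rw [← Finset.erase_insert (fun hh => Finset.notMem_erase _ _ (hYs hh) : x₀ ∉ Y), hins,
        Finset.erase_insert (fun hh => Finset.notMem_erase _ _ (hYs' hh) : x₀ ∉ Y')]

lemma ncard_shuffleLabellings [Finite Υ] [Finite L] (har : ∀ v, 2 ≤ ar v) (s : OpTree ar Unit)
    (X : Finset L) (hX : X.card = s.arity) :
    ((shuffleLabellings s X).ncard : ℚ) = s.arity.factorial * s.shuffleDensity := by
  induction s generalizing X with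
  | leaf u =>
    obtain ⟨x, rfl⟩ := Finset.card_eq_one.1 hX
    have : shuffleLabellings (leaf u : OpTree ar Unit) {x} = {leaf x} := by
      ext t
      constructor
      · rintro ⟨h1, -, -, h4⟩
        cases t with
        | leaf y => simpa [leaves] using h4
        | node v c => cases h1
      · rintro rfl
        exact ⟨rfl, trivial, trivial, by simp [leaves]⟩
    rw [this]
    simp [shuffleDensity, arity]
  | node v c ih =>
    rw [shuffleLabellings_node, Set.ncard_image_of_injective _ (fun c c' h => by injection h),
      ncard_shuffleForests har c ih X hX, hX]
    rfl

/-- Of the `n!` labellings of a planar tree with `n` leaves, the proportion `shuffleDensity` is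
shuffle. -/
theorem ncard_shuffleMonomial_skeleton [Finite Υ] (har : ∀ v, 2 ≤ ar v) (s : OpTree ar Unit) {n : ℕ}
    (hn : s.arity = n) : ({m : ShuffleMonomial ar n | m.1.skeleton = s}.ncard : ℚ) =
      n.factorial * s.shuffleDensity := by
  subst hn
  rw [← ncard_shuffleLabellings har s (Finset.univ : Finset (Fin s.arity)) (by simp)]
  have hset : (fun m : ShuffleMonomial ar s.arity => m.1) '' {m | m.1.skeleton = s} =
      shuffleLabellings s (Finset.univ : Finset (Fin s.arity)) := by
    ext t
    simp only [Set.mem_image, Set.mem_ofPred_eq, shuffleLabellings, Finset.coe_univ]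
    constructor
    · rintro ⟨m, hm, rfl⟩
      exact ⟨hm, m.2.1, (label_bijective_iff _).1 m.2.2⟩
    · rintro ⟨h1, h2, h3⟩
      exact ⟨⟨t, h2, (label_bijective_iff _).2 h3⟩, h1, rfl⟩
  rw [← hset]
  congr 1
  exact (Set.ncard_image_of_injective _ Subtype.val_injective).symm

end Counting

/-! ### Pattern avoidance is recognised by a tree automaton -/

namespace OpTree

variable {Υ : Type*} {ar : Υ → ℕ} {L M : Type*}

/-- The pattern `p` can be found at the root of a tree, which is then `p` with trees attached to its
leaves. -/
inductive RootPattern : OpTree ar Unit → OpTree ar L → Prop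
  | leaf (u : Unit) (t : OpTree ar L) : RootPattern (leaf u) t
  | node (v : Υ) (p : Fin (ar v) → OpTree ar Unit) (c : Fin (ar v) → OpTree ar L) :
      (∀ i, RootPattern (p i) (c i)) → RootPattern (node v p) (node v c)

/-- No pattern from `S` is found at the root of a subtree of `t`. -/
def Avoids (S : Set (OpTree ar Unit)) (t : OpTree ar L) : Prop :=
  ∀ p ∈ S, ∀ u, IsAbove u t → ¬ RootPattern p u

lemma rootPattern_node_iff (v : Υ) (p : Fin (ar v) → OpTree ar Unit)
    (c : Fin (ar v) → OpTree ar L) :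
    RootPattern (OpTree.node v p) (OpTree.node v c) ↔ ∀ i, RootPattern (p i) (c i) :=
  ⟨fun h => by cases h; assumption, RootPattern.node v p c⟩

lemma avoids_node_iff (S : Set (OpTree ar Unit)) (v : Υ) (c : Fin (ar v) → OpTree ar L) :
    Avoids S (OpTree.node v c) ↔
      (∀ p ∈ S, ¬ RootPattern p (OpTree.node v c)) ∧ ∀ i, Avoids S (c i) := by
  constructor
  · exact fun h => ⟨fun p hp => h p hp _ (Or.inl rfl), fun i p hp u hu => h p hp u (Or.inr ⟨i, hu⟩)⟩
  · rintro ⟨h1, h2⟩ p hp u (rfl | ⟨i, hu⟩)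
    · exact h1 p hp
    · exact h2 i p hp u hu

/-- The part of a tree up to the given height: vertices at this height are replaced by leaves, like
the leaves below it. -/
def truncate : ℕ → OpTree ar L → OpTree ar Unit
  | 0, _ => leaf ()
  | _ + 1, leaf _ => leaf ()
  | D + 1, node v c => node v fun i => truncate D (c i)

lemma truncate_truncate_succ (D : ℕ) (t : OpTree ar L) :
    truncate D (truncate (D + 1) t) = truncate D t := by
  induction D generalizing t with
  | zero => rfl
  | succ D ih =>
    cases t with
    | leaf x => rfl
    | node v c => exact congrArg (OpTree.node v) (funext fun i => ih (c i))

lemma truncate_node_congr (D : ℕ) (v : Υ) {c c' : Fin (ar v) → OpTree ar L}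
    (h : ∀ i, truncate D (c i) = truncate D (c' i)) :
    truncate D (node v c) = truncate D (node v c') := by
  cases D with
  | zero => rfl
  | succ D =>
    refine congrArg (OpTree.node v) (funext fun i => ?_)
    rw [← truncate_truncate_succ, h i, truncate_truncate_succ]

lemma finite_range_truncate [Finite Υ] (D : ℕ) :
    (Set.range (truncate D : OpTree ar L → OpTree ar Unit)).Finite := by
  induction D with
  | zero => exact (Set.finite_singleton (leaf ())).subset (by rintro _ ⟨t, rfl⟩; rfl)
  | succ D ih =>
    refine ((Set.finite_singleton (leaf ())).union (Set.finite_iUnion fun v =>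
      (Set.Finite.pi' fun _ : Fin (ar v) => ih).image (node v))).subset ?_
    rintro _ ⟨x | ⟨v, c⟩, rfl⟩
    · exact Or.inl rfl
    · exact Or.inr (Set.mem_iUnion.2 ⟨v, _, fun i => ⟨c i, rfl⟩, rfl⟩)

lemma exists_rootPattern_truncate_iff (p : OpTree ar Unit) :
    ∃ D₀ : ℕ, ∀ D ≥ D₀, ∀ t : OpTree ar L, RootPattern p (truncate D t) ↔ RootPattern p t := by
  induction p with
  | leaf u => exact ⟨0, fun D _ t => iff_of_true (.leaf _ _) (.leaf _ _)⟩
  | node v p ih =>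
    choose D₀ hD₀ using ih
    refine ⟨Finset.univ.sup D₀ + 1, fun D hD t => ?_⟩
    obtain ⟨D, rfl⟩ : ∃ k, D = k + 1 := ⟨D - 1, by omega⟩
    cases t with
    | leaf x => exact ⟨fun h => (by cases h), fun h => (by cases h)⟩
    | node v' c =>
      by_cases hv : v = v'
      · subst hv
        rw [truncate, rootPattern_node_iff, rootPattern_node_iff]
        exact forall_congr' fun i => hD₀ i D
          ((Finset.le_sup (Finset.mem_univ i)).trans (Nat.le_of_succ_le_succ hD)) _
      · exact ⟨fun h => (by cases h; exact absurd rfl hv),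
          fun h => (by cases h; exact absurd rfl hv)⟩

/-- Whether a tree avoids a finite set of patterns is decided by an automaton whose state at a
tree is its part of bounded height, together with the answer for this tree. -/
lemma exists_automaton_avoids.{u} {Υ : Type u} {ar : Υ → ℕ} [Finite Υ]
    {S : Set (OpTree ar Unit)} (hS : S.Finite) :
    ∃ (A : Type u) (_ : Finite A) (σ : OpTree ar Unit → A) (p : A → Prop),
      (∀ v (c c' : Fin (ar v) → OpTree ar Unit), (∀ i, σ (c i) = σ (c' i)) →
        σ (node v c) = σ (node v c')) ∧ ∀ t, Avoids S t ↔ p (σ t) := by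
  choose D₀ hD₀ using exists_rootPattern_truncate_iff (ar := ar) (L := Unit)
  obtain ⟨D, hD⟩ := (hS.image D₀).bddAbove
  have hroot : ∀ p ∈ S, ∀ t, RootPattern p (truncate D t) ↔ RootPattern p t := fun p hp =>
    hD₀ p D (hD ⟨p, hp, rfl⟩)
  refine ⟨Set.range (truncate D : OpTree ar Unit → OpTree ar Unit) × Prop,
    have := (finite_range_truncate (ar := ar) (L := Unit) D).to_subtype
    inferInstance, fun t => (⟨truncate D t, t, rfl⟩, Avoids S t), Prod.snd, ?_, fun t => Iff.rfl⟩
  intro v c c' h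
  have h1 : truncate D (node v c) = truncate D (node v c') :=
    truncate_node_congr D v fun i => congrArg (fun a => a.1.1) (h i)
  refine Prod.ext (Subtype.ext h1) (propext ?_)
  change Avoids S (node v c) ↔ Avoids S (node v c')
  rw [avoids_node_iff, avoids_node_iff]
  refine and_congr (forall₂_congr fun p hp => ?_) (forall_congr' fun i => ?_)
  · rw [← hroot p hp, h1, hroot p hp]
  · exact iff_of_eq (congrArg (fun a => a.2) (h i))

end OpTree

/-! ### Divisibility by a shuffle regular set depends on the planar skeleton -/

namespace OpTree

variable {Υ : Type*} {ar : Υ → ℕ} {L M : Type*}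

lemma relabel_bind {N : Type*} (t : OpTree ar L) (f : L → M) (g : M → OpTree ar N) :
    (t.relabel f).bind g = t.bind fun x => g (f x) :=
  bind_bind _ _ _

lemma skeleton_eq_self (t : OpTree ar Unit) : t.skeleton = t := by
  induction t with
  | leaf x => rfl
  | node v c ih => exact congrArg (node v) (funext ih)

lemma rootPattern_bind (t : OpTree ar L) (f : L → OpTree ar M) :
    RootPattern t.skeleton (t.bind f) := by
  induction t with
  | leaf x => exact .leaf _ _
  | node v c ih => exact .node _ _ _ ih

lemma rootPattern_of_skeleton {p : OpTree ar Unit} {t : OpTree ar L}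
    (h : RootPattern p t.skeleton) : RootPattern p t := by
  induction p generalizing t with
  | leaf u => exact .leaf _ _
  | node v p ih =>
    cases t with
    | leaf x => cases h
    | node v' c =>
      rw [skeleton_node] at h
      cases h with
      | node _ _ _ h => exact .node _ _ _ fun i => ih i (h i)

lemma IsAbove.skeleton {u t : OpTree ar L} (h : u.IsAbove t) : u.skeleton.IsAbove t.skeleton := by
  induction t with
  | leaf x => rw [show u = leaf x from h]; rfl
  | node v c ih =>
    rcases h with rfl | ⟨i, hi⟩
    · exact Or.inl rfl
    · exact Or.inr ⟨i, ih i hi⟩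

lemma exists_isAbove_of_skeleton {u : OpTree ar Unit} {t : OpTree ar L}
    (h : u.IsAbove t.skeleton) : ∃ u' : OpTree ar L, u'.IsAbove t ∧ u'.skeleton = u := by
  induction t with
  | leaf x => exact ⟨leaf x, rfl, (show u = leaf () from h).symm⟩
  | node v c ih =>
    rcases h with rfl | ⟨i, hi⟩
    · exact ⟨node v c, Or.inl rfl, rfl⟩
    · obtain ⟨u', h1, h2⟩ := ih i hi
      exact ⟨u', Or.inr ⟨i, h1⟩, h2⟩

lemma IsAbove.isShuffle [LT L] {u t : OpTree ar L} (h : u.IsAbove t) (ht : t.IsShuffle) :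
    u.IsShuffle := by
  induction t with
  | leaf x => rw [show u = leaf x from h]; trivial
  | node v c ih =>
    rcases h with rfl | ⟨i, hi⟩
    · exact ht
    · exact ih i hi (ht.2 i)

lemma IsAbove.leavesDisjoint {u t : OpTree ar L} (h : u.IsAbove t) (ht : t.LeavesDisjoint) :
    u.LeavesDisjoint := by
  induction t with
  | leaf x => rw [show u = leaf x from h]; trivial
  | node v c ih =>
    rcases h with rfl | ⟨i, hi⟩
    · exact ht
    · exact ih i hi (ht.2 i)

lemma LeavesDisjoint.relabel {f : L → M} (hf : Function.Injective f) {t : OpTree ar L}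
    (ht : t.LeavesDisjoint) : (t.relabel f).LeavesDisjoint := by
  induction t with
  | leaf x => trivial
  | node v c ih =>
    refine ⟨fun i j hij => ?_, fun i => ih i (ht.2 i)⟩
    have := (Set.disjoint_image_iff hf).2 (ht.1 hij)
    rwa [← leaves_relabel, ← leaves_relabel] at this

/-- The tree whose leaves are labelled from left to right. -/
def posTree : (t : OpTree ar L) → OpTree ar (Fin t.arity)
  | leaf _ => leaf (0 : Fin 1)
  | node v c => node v fun i =>
      (c i).posTree.relabel fun q => blockEquiv (fun i => (c i).arity) ⟨i, q⟩

lemma skeleton_posTree (t : OpTree ar L) : t.posTree.skeleton = t.skeleton := by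
  induction t with
  | leaf x => rfl
  | node v c ih =>
    rw [posTree, skeleton_node, skeleton_node]
    exact congrArg (node v) (funext fun i => (skeleton_relabel _ _).trans (ih i))

lemma leaves_posTree (t : OpTree ar L) : t.posTree.leaves = Set.univ := by
  induction t with
  | leaf x => exact Set.eq_univ_of_forall fun y => Subsingleton.elim (α := Fin 1) y 0
  | node v c ih =>
    rw [Set.eq_univ_iff_forall]
    intro y
    obtain ⟨⟨i, q⟩, rfl⟩ := (blockEquiv fun i => (c i).arity).surjective y
    exact Set.mem_iUnion.2 ⟨i, (leaves_relabel _ _).symm.subset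
      ⟨q, (ih i).symm.subset trivial, rfl⟩⟩

lemma leavesDisjoint_posTree (t : OpTree ar L) : t.posTree.LeavesDisjoint := by
  induction t with
  | leaf x => trivial
  | node v c ih =>
    refine ⟨fun i j hij => ?_, fun i => (ih i).relabel fun q q' h => ?_⟩
    · refine Set.disjoint_left.2 fun y hy hy' => ?_
      obtain ⟨q, -, rfl⟩ := (leaves_relabel _ _).subset hy
      obtain ⟨q', -, h⟩ := (leaves_relabel _ _).subset hy'
      exact hij (congrArg Sigma.fst ((blockEquiv _).injective h)).symm
    · exact eq_of_heq (Sigma.mk.inj ((blockEquiv fun i => (c i).arity).injective h)).2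

lemma RootPattern.exists_bind {p : OpTree ar Unit} {t : OpTree ar L} (h : RootPattern p t) :
    ∃ g : Fin p.arity → OpTree ar L, p.posTree.bind g = t := by
  induction h with
  | leaf u t => exact ⟨fun _ => t, rfl⟩
  | node v p c _ ih =>
    choose g hg using ih
    refine ⟨fun y => g ((blockEquiv fun i => (p i).arity).symm y).1
      ((blockEquiv fun i => (p i).arity).symm y).2, ?_⟩
    refine congrArg (OpTree.node v) (funext fun i => ?_)
    refine (relabel_bind _ _ _).trans (Eq.trans ?_ (hg i))
    congr 1
    funext q
    rw [Equiv.symm_apply_apply]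

lemma LeavesDisjoint.of_bind {t : OpTree ar L} {g : L → OpTree ar M}
    (h : (t.bind g).LeavesDisjoint) {x y : L} (hx : x ∈ t.leaves) (hy : y ∈ t.leaves)
    (hxy : x ≠ y) : Disjoint (g x).leaves (g y).leaves := by
  induction t with
  | leaf z => exact absurd ((show x = z from hx).trans (show y = z from hy).symm) hxy
  | node v c ih =>
    obtain ⟨i, hi⟩ := Set.mem_iUnion.1 hx
    obtain ⟨j, hj⟩ := Set.mem_iUnion.1 hy
    by_cases hij : i = j
    · subst hij
      exact ih i (h.2 i) hi hj
    · refine (h.1 hij).mono ?_ ?_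
      · rw [leaves_bind]
        exact Set.subset_biUnion_of_mem (u := fun x => (g x).leaves) hi
      · rw [leaves_bind]
        exact Set.subset_biUnion_of_mem (u := fun x => (g x).leaves) hj

/-- Contracting attached trees to leaves numbered by their order preserves shuffle trees. -/
lemma IsShuffle.relabel_of_bind [LT L] [LT M] {N : Type*} {t : OpTree ar N} {g : N → OpTree ar L}
    (h : (t.bind g).IsShuffle) (ρ : N → M) (hρ : ∀ x y, MinLT (g x) (g y) → ρ x < ρ y) :
    (t.relabel ρ).IsShuffle := by
  induction t with
  | leaf x => trivial
  | node v c ih =>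
    refine ⟨fun i j hij => ?_, fun i => ih i (h.2 i)⟩
    obtain ⟨l, hl, hlt⟩ := h.1 i j hij
    rw [leaves_bind] at hl hlt
    simp only [Set.mem_iUnion] at hl hlt
    obtain ⟨x, hx, hlx⟩ := hl
    refine ⟨ρ x, ?_, ?_⟩
    · change ρ x ∈ ((c i).relabel ρ).leaves
      rw [leaves_relabel]
      exact ⟨x, hx, rfl⟩
    · intro y hy
      change y ∈ ((c j).relabel ρ).leaves at hy
      rw [leaves_relabel] at hy
      obtain ⟨y, hy, rfl⟩ := hy
      exact hρ x y ⟨l, hlx, fun l' hl' => hlt l' ⟨y, hy, hl'⟩⟩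

end OpTree

open OpTree in
/-- An occurrence of a planar pattern in a shuffle monomial, with the leaves of the pattern
numbered by the order of the minima above them, is a division by a shuffle monomial with this
pattern as planar skeleton. -/
lemma ShuffleMonomial.exists_divides_of_rootPattern {Υ : Type*} {ar : Υ → ℕ} (har : ∀ v, 2 ≤ ar v)
    {n : ℕ} (m : ShuffleMonomial ar n) {p : OpTree ar Unit} {u : OpTree ar (Fin n)}
    (hu : u.IsAbove m.1) (hp : RootPattern p u) {l : ℕ} (hl : p.arity = l) :
    ∃ w : ShuffleMonomial ar l, w.1.skeleton = p ∧ w.Divides m := by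
  subst hl
  obtain ⟨g, rfl⟩ := hp.exists_bind
  have hdisj : ∀ x y, x ≠ y → Disjoint (g x).leaves (g y).leaves := fun x y hxy =>
    (hu.leavesDisjoint ((label_bijective_iff _).1 m.2.2).1).of_bind
      (by rw [leaves_posTree]; trivial) (by rw [leaves_posTree]; trivial) hxy
  have hmin : ∀ x, ∃ l, IsLeast (g x).leaves l := fun x => by
    obtain ⟨l, hl, hle⟩ := Set.exists_min_image _ id (finite_leaves (g x)) (leaves_nonempty har _)
    exact ⟨l, hl, fun y hy => hle y hy⟩
  choose μ hμ using hmin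
  have hμinj : Function.Injective μ := fun x y h => by
    by_contra hxy
    exact Set.disjoint_left.1 (hdisj x y hxy) (hμ x).1 (h ▸ (hμ y).1)
  let τ : Equiv.Perm (Fin p.arity) := Tuple.sort μ
  have hτ : StrictMono (μ ∘ τ) :=
    (Tuple.monotone_sort μ).strictMono_of_injective (hμinj.comp τ.injective)
  have hρ : ∀ x y, MinLT (g x) (g y) → τ.symm x < τ.symm y := by
    rintro x y ⟨l, hl, hlt⟩
    have : μ x < μ y := ((hμ x).2 hl).trans_lt (hlt _ (hμ y).1)
    rw [← hτ.lt_iff_lt]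
    simpa using this
  refine ⟨⟨p.posTree.relabel τ.symm, (hu.isShuffle m.2.1).relabel_of_bind _ hρ, ?_⟩, ?_,
    fun x => g (τ x), ?_, ?_⟩
  · rw [label_bijective_iff, leaves_relabel, leaves_posTree, Set.image_univ]
    exact ⟨(leavesDisjoint_posTree p).relabel τ.symm.injective, τ.symm.surjective.range_eq⟩
  · change (p.posTree.relabel τ.symm).skeleton = p
    rw [skeleton_relabel, skeleton_posTree]
    exact skeleton_eq_self p
  · change ((p.posTree.relabel τ.symm).bind fun x => g (τ x)).IsAbove m.1
    have : (p.posTree.relabel τ.symm).bind (fun x => g (τ x)) = p.posTree.bind g := by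
      rw [relabel_bind]
      congr 1
      funext x
      rw [Equiv.apply_symm_apply]
    rwa [this]
  · intro i j hij
    exact ⟨_, (hμ (τ i)).1, fun y hy => (hτ hij).trans_le ((hμ (τ j)).2 hy)⟩

open OpTree in
/-- A monomial is outside the monomial ideal generated by a shuffle regular set if and only if its
planar skeleton avoids the planar skeletons of this set. -/
theorem notMem_monomialMultiples_iff {Υ : Type*} {ar : Υ → ℕ} (har : ∀ v, 2 ≤ ar v)
    {S : Set (Σ n, ShuffleMonomial ar n)} (hS : ShuffleRegular S) {n : ℕ}
    (m : ShuffleMonomial ar n) :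
    (⟨n, m⟩ : Σ n, ShuffleMonomial ar n) ∉ monomialMultiples S ↔
      Avoids ((fun w : Σ n, ShuffleMonomial ar n => w.2.1.skeleton) '' S) m.1.skeleton := by
  constructor
  · rintro h _ ⟨⟨l, w₀⟩, hw₀, rfl⟩ u hu hp
    obtain ⟨u', hu', rfl⟩ := exists_isAbove_of_skeleton hu
    have hl : w₀.1.skeleton.arity = l := by
      rw [arity_skeleton]
      simpa using Fintype.card_of_bijective w₀.2.2
    obtain ⟨w, hw, hdiv⟩ := m.exists_divides_of_rootPattern har hu' (rootPattern_of_skeleton hp) hl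
    exact h ⟨_, hS _ w₀ w hw₀ hw, hdiv⟩
  · rintro h ⟨⟨l, w⟩, hw, f, habove, -⟩
    refine h _ ⟨_, hw, rfl⟩ _ habove.skeleton ?_
    rw [skeleton_bind]
    exact rootPattern_bind _ _

/-! ### Normal monomials form bases of the components of the operad -/

section NormalMonomials

open OpTree

variable {k : Type*} [Field k] {Υ : Type*} {ar : Υ → ℕ}

lemma finite_shuffleMonomial [Finite Υ] (har : ∀ v, 2 ≤ ar v) (n : ℕ) :
    Finite (ShuffleMonomial ar n) := by
  have := (finite_arity_eq (L := Fin n) har n).to_subtype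
  refine Finite.of_injective
    (β := {t : OpTree ar (Fin n) | t.arity = n}) (fun m => ⟨m.1, ?_⟩) fun m m' h => ?_
  · simpa using Fintype.card_of_bijective m.2.2
  · exact Subtype.ext (congrArg (fun t => t.1) h)

lemma AdmissibleOrder.exists_isLeading (ord : AdmissibleOrder ar) {n : ℕ} {f : FreeShuffle k ar n}
    (hf : f ≠ 0) : ∃ m, ord.IsLeading f m := by
  classical
  have := ord.total n
  let : LinearOrder (ShuffleMonomial ar n) := linearOrderOfSTO ord.lt
  obtain ⟨m, hm, hmax⟩ := f.support.exists_max_image id (Finsupp.support_nonempty_iff.2 hf)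
  exact ⟨m, hm, fun m' hm' hne => lt_of_le_of_ne (hmax m' hm') hne⟩

lemma AdmissibleOrder.finite_leadingMonomials (ord : AdmissibleOrder ar)
    {G : Set (Σ n, FreeShuffle k ar n)} (hG : G.Finite) : (ord.leadingMonomials G).Finite := by
  refine (hG.biUnion fun f _ => (f.2.support.finite_toSet.image
    fun m => (⟨f.1, m⟩ : Σ n, ShuffleMonomial ar n))).subset ?_
  rintro ⟨n, m⟩ ⟨f, hf, hm⟩
  exact Set.mem_biUnion hf ⟨m, hm.1, rfl⟩

lemma OpTree.degree_zero {L : Type*} (t : OpTree ar L) : t.degree (fun _ => 0) = 0 := by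
  induction t with
  | leaf x => rfl
  | node v c ih => simp [degree, ih]

namespace SymmetricOperad

variable (P : SymmetricOperad k) (x : ∀ v, P.obj (ar v)) (ord : AdmissibleOrder ar)

/-- The normal monomials of arity `n`: those which are not leading monomials of relations. -/
def normalMonomials (n : ℕ) : Set (ShuffleMonomial ar n) :=
  {m | (⟨n, m⟩ : Σ n, ShuffleMonomial ar n) ∉ ord.leadingMonomials (P.relationSet x)}

/-- A linear relation between normal monomials would have a leading monomial. -/
lemma linearIndepOn_normalMonomials (n : ℕ) :
    LinearIndepOn k (P.eval (n := n) x) (P.normalMonomials x ord n) := by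
  rw [linearIndepOn_iff]
  intro f hf hf0
  by_contra hne
  obtain ⟨m, hm⟩ := ord.exists_isLeading hne
  exact (Finsupp.mem_supported k f).1 hf hm.1 ⟨f, hf0, hm⟩

/-- Reduction modulo relations: the leading monomial of a homogeneous relation is a combination of
smaller monomials of the same degree. -/
lemma eval_mem_span_normalMonomials [Finite Υ] (har : ∀ v, 2 ≤ ar v) {deg : Υ → ℤ}
    (hdeg : P.HomogeneousRelations x deg) {n : ℕ} (m : ShuffleMonomial ar n) :
    P.eval x m ∈ Submodule.span k
      (P.eval x '' {m' | m' ∈ P.normalMonomials x ord n ∧ m'.1.degree deg = m.1.degree deg}) := by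
  classical
  have := ord.total n
  have := finite_shuffleMonomial har n
  have hwf : WellFounded (ord.lt (n := n)) := Finite.wellFounded_of_trans_of_irrefl _
  induction m using hwf.induction with
  | _ m ih =>
    by_cases hm : m ∈ P.normalMonomials x ord n
    · exact Submodule.subset_span ⟨m, ⟨hm, rfl⟩, rfl⟩
    · obtain ⟨f, hf, hlead⟩ := not_not.1 hm
      set f' : FreeShuffle k ar n := f.filter fun m' => m'.1.degree deg = m.1.degree deg with hf'
      have hfm : f' m ≠ 0 := by
        have : f' m = f m := Finsupp.filter_apply_pos
          (fun m' : ShuffleMonomial ar n => m'.1.degree deg = m.1.degree deg) f rfl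
        rw [this]
        exact Finsupp.mem_support_iff.1 hlead.1
      have hrel : Finsupp.linearCombination k (P.eval (n := n) x) f' = 0 :=
        hdeg n f hf (m.1.degree deg)
      rw [Finsupp.linearCombination_apply, Finsupp.sum,
        ← Finset.add_sum_erase _ _ (Finsupp.mem_support_iff.2 hfm)] at hrel
      rw [← Submodule.smul_mem_iff _ hfm, eq_neg_of_add_eq_zero_left hrel]
      refine neg_mem (sum_mem fun m' hm' => Submodule.smul_mem _ _ ?_)
      obtain ⟨hne, hm'⟩ := Finset.mem_erase.1 hm'
      rw [hf', Finsupp.support_filter, Finset.mem_filter] at hm'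
      have := ih m' (hlead.2 m' hm'.1 hne)
      rwa [hm'.2] at this

lemma finrank_gradedPart [Finite Υ] (har : ∀ v, 2 ≤ ar v) {deg : Υ → ℤ}
    (hdeg : P.HomogeneousRelations x deg) (n : ℕ) (d : ℤ) :
    Module.finrank k (P.gradedPart x deg n d) =
      {m | m ∈ P.normalMonomials x ord n ∧ m.1.degree deg = d}.ncard := by
  have := finite_shuffleMonomial har n
  have hspan : P.gradedPart x deg n d =
      Submodule.span k (P.eval x '' {m | m ∈ P.normalMonomials x ord n ∧ m.1.degree deg = d}) := by
    refine le_antisymm (Submodule.span_le.2 ?_)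
      (Submodule.span_mono (Set.image_mono fun m h => h.2))
    rintro _ ⟨m, rfl, rfl⟩
    exact P.eval_mem_span_normalMonomials x ord har hdeg m
  have hind : LinearIndepOn k (P.eval (n := n) x)
      {m | m ∈ P.normalMonomials x ord n ∧ m.1.degree deg = d} :=
    (P.linearIndepOn_normalMonomials x ord n).mono fun m h => h.1
  have : Fintype {m | m ∈ P.normalMonomials x ord n ∧ m.1.degree deg = d} := Fintype.ofFinite _
  rw [hspan, Set.image_eq_range, finrank_span_eq_card hind, ← Nat.card_eq_fintype_card,
    Nat.card_coe_set_eq]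

lemma homogeneousRelations_zero : P.HomogeneousRelations x (fun _ => 0) := by
  intro n f hf d
  by_cases hd : 0 = d
  · rwa [Finsupp.filter_eq_self_iff _ _ |>.2 fun m _ => (degree_zero m.1).trans hd]
  · rw [Finsupp.filter_eq_zero_iff _ _ |>.2 fun m h => absurd ((degree_zero m.1).symm.trans h) hd]
    exact zero_mem _

/-- The ungraded case is the case of degree zero for all generators. -/
lemma finrank_obj [Finite Υ] (har : ∀ v, 2 ≤ ar v) (hgen : P.IsGeneratedBy x) {n : ℕ} (hn : 1 ≤ n) :
    Module.finrank k (P.obj n) = (P.normalMonomials x ord n).ncard := by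
  have hset : {m | m ∈ P.normalMonomials x ord n ∧ m.1.degree (fun _ => 0) = 0} =
      P.normalMonomials x ord n := Set.ext fun m => and_iff_left (degree_zero m.1)
  have htop : P.gradedPart x (fun _ => 0) n 0 = ⊤ := by
    refine top_le_iff.1 ((hgen n hn).ge.trans (Submodule.span_mono ?_))
    rintro _ ⟨m, rfl⟩
    exact ⟨m, degree_zero m.1, rfl⟩
  rw [← congrArg Set.ncard hset,
    ← P.finrank_gradedPart x ord har (P.homogeneousRelations_zero x) n 0, htop, finrank_top]

end SymmetricOperad

end NormalMonomials

/-! ### The generating series of the normal monomials -/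

section NormalSeries

open OpTree PowerSeries

variable {k : Type*} [Field k] {Υ : Type*} {ar : Υ → ℕ}

lemma OpTree.weight_skeleton {R L : Type*} [CommRing R] (w : Υ → R) (t : OpTree ar L) :
    t.skeleton.weight w = t.weight w := by
  induction t with
  | leaf x => rfl
  | node v c ih => exact congrArg (w v * ·) (Finset.prod_congr rfl fun i _ => ih i)

/-- Summation over shuffle monomials, collected by planar skeletons. -/
lemma sum_shuffleMonomial_skeleton [Finite Υ] (har : ∀ v, 2 ≤ ar v) {R : Type*} [CommRing R]
    [Algebra ℚ R] (n : ℕ) [Fintype (ShuffleMonomial ar n)] (F : OpTree ar Unit → R) :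
    ∑ m : ShuffleMonomial ar n, F m.1.skeleton = (n.factorial : ℚ) •
      ∑ s ∈ (finite_arity_eq (L := Unit) har n).toFinset, s.shuffleDensity • F s := by
  classical
  rw [← Finset.sum_fiberwise_of_maps_to' (s := Finset.univ)
    (t := (finite_arity_eq (L := Unit) har n).toFinset)
    (g := fun m : ShuffleMonomial ar n => m.1.skeleton) _ F, Finset.smul_sum]
  · refine Finset.sum_congr rfl fun s hs => ?_
    rw [Finset.sum_const, ← Nat.cast_smul_eq_nsmul ℚ, smul_smul,
      ← ncard_shuffleMonomial_skeleton har s (by simpa using hs), ← Set.ncard_coe_finset]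
    simp
  · intro m _
    rw [Set.Finite.mem_toFinset, Set.mem_ofPred_eq, arity_skeleton]
    simpa using Fintype.card_of_bijective m.2.2

/-- For a finite shuffle regular Gröbner basis, the weighted exponential generating series of the
normal monomials belongs to a finite quadratically closed set. -/
theorem SymmetricOperad.exists_quadraticallyClosed_normalMonomials (P : SymmetricOperad k)
    [Finite Υ] (har : ∀ v, 2 ≤ ar v) (x : ∀ v, P.obj (ar v)) (ord : AdmissibleOrder ar)
    {G : Set (Σ n, FreeShuffle k ar n)} (hfin : G.Finite) (hG : P.IsGroebnerBasis x ord G)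
    (hreg : ShuffleRegular (ord.leadingMonomials G)) {R : Type*} [CommRing R] [Algebra ℚ R]
    (w : Υ → R) :
    ∃ 𝒴 : Set R⟦X⟧, 𝒴.Finite ∧ IsQuadraticallyClosed 𝒴 ∧
      (PowerSeries.mk fun n => (n.factorial : ℚ)⁻¹ •
        ∑ᶠ (m) (_ : m ∈ P.normalMonomials x ord n), m.1.weight w) ∈ 𝒴 := by
  classical
  obtain ⟨A, _, σ, p, hσ, hp⟩ := exists_automaton_avoids
    ((ord.finite_leadingMonomials hfin).image fun w => w.2.1.skeleton)
  obtain ⟨𝒴, h1, h2, h3⟩ := exists_quadraticallyClosed har w σ hσ p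
  refine ⟨𝒴, h1, h2, ?_⟩
  convert h3 using 1
  ext n
  have := finite_shuffleMonomial har n
  cases nonempty_fintype (ShuffleMonomial ar n)
  have hnormal : ∀ m : ShuffleMonomial ar n,
      m ∈ P.normalMonomials x ord n ↔ p (σ m.1.skeleton) := fun m => by
    rw [← hp, ← notMem_monomialMultiples_iff har hreg, hG.2]
    rfl
  have hsum := sum_shuffleMonomial_skeleton har n fun s => if p (σ s) then s.weight w else 0
  rw [coeff_mk, coeff_genSeries (finite_arity_eq har), finsum_eq_sum_of_fintype]
  simp only [finsum_eq_if, hnormal]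
  simp only [weight_skeleton] at hsum
  rw [hsum, smul_smul, inv_mul_cancel₀ (by positivity), one_smul]
  simp only [smul_ite, smul_zero]

lemma finsum_weight_one_eq_ncard {n : ℕ} {s : Set (ShuffleMonomial ar n)} (hs : s.Finite) :
    ∑ᶠ (m) (_ : m ∈ s), m.1.weight (fun _ => (1 : ℚ)) = s.ncard := by
  have : ∀ t : OpTree ar (Fin n), t.weight (fun _ => (1 : ℚ)) = 1 := fun t => by
    induction t with
    | leaf x => rfl
    | node v c ih => simp [OpTree.weight, ih]
  simp only [this]
  rw [finsum_mem_eq_finite_toFinset_sum _ hs, Finset.sum_const, nsmul_one,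
    Set.ncard_eq_toFinset_card _ hs]

lemma OpTree.weight_T {L : Type*} (deg : Υ → ℤ) (t : OpTree ar L) :
    t.weight (fun v => (LaurentPolynomial.T (deg v) : ℚ[T;T⁻¹])) =
      LaurentPolynomial.T (t.degree deg) := by
  have hsum : ∀ {m : ℕ} (a : Fin m → ℤ),
      (LaurentPolynomial.T (∑ i, a i) : ℚ[T;T⁻¹]) = ∏ i, LaurentPolynomial.T (a i) := by
    intro m a
    induction m with
    | zero => simp
    | succ m ih => rw [Fin.sum_univ_succ, Fin.prod_univ_succ, LaurentPolynomial.T_add, ih]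
  induction t with
  | leaf x => exact LaurentPolynomial.T_zero.symm
  | node v c ih =>
    rw [degree, LaurentPolynomial.T_add, hsum]
    exact congrArg (LaurentPolynomial.T (deg v) * ·) (Finset.prod_congr rfl fun i _ => ih i)

/-- A finite sum of powers of `T`, collected by exponents. -/
lemma finsum_T_eq {α : Type*} (d : α → ℤ) {s : Set α} (hs : s.Finite) :
    ∑ᶠ (a) (_ : a ∈ s), (LaurentPolynomial.T (d a) : ℚ[T;T⁻¹]) =
      ∑ᶠ e : ℤ, (({a | a ∈ s ∧ d a = e}.ncard : ℕ) : ℚ) • LaurentPolynomial.T e := by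
  classical
  rw [finsum_mem_eq_finite_toFinset_sum _ hs,
    finsum_eq_sum_of_support_subset (s := hs.toFinset.image d),
    ← Finset.sum_fiberwise_of_maps_to' (fun a ha => Finset.mem_image_of_mem d ha)]
  · refine Finset.sum_congr rfl fun e _ => ?_
    rw [Finset.sum_const, ← Nat.cast_smul_eq_nsmul ℚ, ← Set.ncard_coe_finset]
    simp
  · intro e he
    have hne : {a | a ∈ s ∧ d a = e}.ncard ≠ 0 := fun h0 => he (by simp only [h0]; simp)
    obtain ⟨a, ha, rfl⟩ := Set.nonempty_of_ncard_ne_zero hne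
    simpa using ⟨a, ha, rfl⟩

lemma isEmpty_shuffleMonomial_zero (har : ∀ v, 2 ≤ ar v) : IsEmpty (ShuffleMonomial ar 0) :=
  ⟨fun m => (m.1.label ⟨0, arity_pos har m.1⟩).elim0⟩

lemma SymmetricOperad.expSeries_eq (P : SymmetricOperad k) [Finite Υ] (har : ∀ v, 2 ≤ ar v)
    (x : ∀ v, P.obj (ar v)) (hgen : P.IsGeneratedBy x) (ord : AdmissibleOrder ar) :
    P.expSeries = PowerSeries.mk fun n => (n.factorial : ℚ)⁻¹ •
      ∑ᶠ (m) (_ : m ∈ P.normalMonomials x ord n), m.1.weight (fun _ => (1 : ℚ)) := by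
  ext n
  have := finite_shuffleMonomial har n
  rw [expSeries, coeff_mk, coeff_mk, finsum_weight_one_eq_ncard (Set.toFinite _)]
  rcases Nat.eq_zero_or_pos n with rfl | hn
  · have := isEmpty_shuffleMonomial_zero har
    simp [Set.eq_empty_of_isEmpty]
  · rw [if_neg hn.ne', P.finrank_obj x ord har hgen hn, smul_eq_mul, div_eq_inv_mul]

lemma SymmetricOperad.gradedExpSeries_eq (P : SymmetricOperad k) [Finite Υ] (har : ∀ v, 2 ≤ ar v)
    (x : ∀ v, P.obj (ar v)) (ord : AdmissibleOrder ar) {deg : Υ → ℤ}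
    (hdeg : P.HomogeneousRelations x deg) :
    P.gradedExpSeries x deg = PowerSeries.mk fun n => (n.factorial : ℚ)⁻¹ •
      ∑ᶠ (m) (_ : m ∈ P.normalMonomials x ord n),
        m.1.weight (fun v => (LaurentPolynomial.T (deg v) : ℚ[T;T⁻¹])) := by
  ext1 n
  have := finite_shuffleMonomial har n
  simp only [gradedExpSeries, coeff_mk, weight_T]
  rcases Nat.eq_zero_or_pos n with rfl | hn
  · have := isEmpty_shuffleMonomial_zero har
    rw [if_pos rfl, finsum_of_isEmpty, smul_zero]
  · rw [if_neg hn.ne', hilbert, finsum_T_eq (fun m : ShuffleMonomial ar n => m.1.degree deg)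
      (Set.toFinite _)]
    simp only [P.finrank_gradedPart x ord har hdeg]

end NormalSeries

/-! ### Laurent polynomials as coefficients -/

lemma LaurentPolynomial.isAlgebraic_polynomial :
    Algebra.IsAlgebraic (Polynomial ℚ) ℚ[T;T⁻¹] := by
  refine ⟨fun f => ?_⟩
  induction f using LaurentPolynomial.induction_on_mul_T with
  | _ f n =>
    refine IsAlgebraic.mul (isAlgebraic_algebraMap f) ?_
    have h : IsAlgebraic (Polynomial ℚ) (LaurentPolynomial.T (n : ℤ) : ℚ[T;T⁻¹]) := by
      rw [← LaurentPolynomial.algebraMap_X_pow]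
      exact isAlgebraic_algebraMap _
    exact h.invOf

end

theorem mainTheorem3 {k : Type*} [Field k] [CharZero k] (P : SymmetricOperad k)
    {Υ : Type*} [Finite Υ] (ar : Υ → ℕ) (har : ∀ v, 2 ≤ ar v)
    (x : ∀ v, P.obj (ar v)) (hgen : P.IsGeneratedBy x)
    (ord : AdmissibleOrder ar) (G : Set (Σ n, FreeShuffle k ar n)) (hfin : G.Finite)
    (hG : P.IsGroebnerBasis x ord G) (hreg : ShuffleRegular (ord.leadingMonomials G)) :
    (∃ (n N : ℕ) (_ : N ≤ n) (q : Fin n → Fin n → Fin n → ℚ) (g : Fin n → Polynomial ℚ)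
      (y : Fin n → PowerSeries ℚ),
        SolvesQuadraticSystem q g y ∧ (∀ y', SolvesQuadraticSystem q g y' → y' = y) ∧
        P.expSeries = ∑ i ∈ Finset.univ.filter (fun i : Fin n => (i : ℕ) < N), y i) ∧
    DifferentialAlgebraic ℚ P.expSeries ∧
    ∀ deg : Υ → ℤ, P.HomogeneousRelations x deg →
      DifferentialAlgebraic (Polynomial ℚ) (P.gradedExpSeries x deg) := by
  obtain ⟨𝒴, h𝒴, hclosed, hmem⟩ := P.exists_quadraticallyClosed_normalMonomials har x ord hfin hG
    hreg fun _ => (1 : ℚ)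
  rw [← P.expSeries_eq har x hgen ord] at hmem
  refine ⟨hclosed.exists_solvesQuadraticSystem h𝒴 hmem, hclosed.differentialAlgebraic h𝒴 hmem,
    fun deg hdeg => ?_⟩
  obtain ⟨𝒵, h𝒵, hclosed', hmem'⟩ := P.exists_quadraticallyClosed_normalMonomials har x ord hfin hG
    hreg fun v => (LaurentPolynomial.T (deg v) : ℚ[T;T⁻¹])
  rw [← P.gradedExpSeries_eq har x ord hdeg] at hmem'
  have := LaurentPolynomial.isAlgebraic_polynomial
  have : FaithfulSMul (Polynomial ℚ) ℚ[T;T⁻¹] :=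
    (faithfulSMul_iff_algebraMap_injective _ _).2 Polynomial.toLaurent_injective
  exact hclosed'.differentialAlgebraic h𝒵 hmem'
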